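/- Consider the Gaussian sequence model $Y_j=b_j\theta_j+\varepsilon\xi_j$, $j\in\mathbb N=\{1,2,\dots\}$, with $\xi_j$ independent standard Gaussian, $b_j>0$, $\varepsilon>0$ and $\theta\in\ell^2(\mathbb N)$; let $\mathbb P_\theta$ be the law of $Y=(Y_j)_j$. Let $(a_j)$ be a non-decreasing sequence of positive reals and put $\mathcal E_a=\{\theta\in\ell^2:\sum_j a_j^2\theta_j^2\le 1\}$ and $\Theta_a(r)=\{\theta\in\mathcal E_a:\|\theta\|\ge r\}$. Suppose that, for some $s,t>0$, $a_j\asymp j^{s}$ and $b_j\asymp j^{-t}$ (that is, the ratios $a_j/j^s$ and $b_j/j^{-t}$ lie between two positive constants for all $j\in\mathbb N$). A test is a measurable $\{0,1\}$-valued function $\Psi$ of $Y$. For $\beta\in(0,1)$ its separation radius is $r_\varepsilon(\mathcal E_a,\Psi,\beta)=\inf\{r>0:\ \sup_{\theta\in\Theta_a(r)}\mathbb P_\theta(\Psi=0)\le\beta\}$, and for $\alpha\in(0,1)$ the minimax separation radius is $\tilde r_\varepsilon=\inf_{\Psi}r_\varepsilon(\mathcal E_a,\Psi,\beta)$, the infimum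 being over all tests $\Psi$ with $\mathbb P_0(\Psi=1)\le\alpha$. For $r>0$ let $\bar\theta=\bar\theta(r)$ be a minimizer of $\theta\mapsto\frac1{2\varepsilon^4}\sum_k b_k^4\theta_k^4$ over $\Theta_a(r)$. The Ingster test at radius $r$ is $$\Psi_{r,I}=\mathbf 1\Big\{\sum_{j}\omega_{j}\big((Y_j/\varepsilon)^2-1\big)>t_{1-\alpha}\Big\},\qquad \omega_j=\frac{b_j^2\bar\theta_j^2}{\sqrt{2\sum_k b_k^4\bar\theta_k^4}},$$ where $t_{1-\alpha}$ is the $(1-\alpha)$-quantile of the standard Gaussian distribution. Let $\alpha,\beta\in(0,1)$ with $\alpha+\beta<1$, let $\mathcal C_0>0$ and $c'=c'(\alpha,\beta)>0$ be any constants, and define $\rho_\varepsilon>0$ by $$\rho_\varepsilon^2=\inf_{R\ge 2}\big[\mathcal C_0R^{-2s}\vee c'(\alpha,\beta)\,\varepsilon^2R^{2t+1/2}\big].$$ Then there exist constants $\mathcal C\ge 1$ and $\varepsilon_0>0$, not depending on $\varepsilon$, such that, for all $0<\varepsilon<\varepsilon_0$, the extremal problem at radius $r=\rho_\varepsilon$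 has a solution and, for every solution $\bar\theta$ of it, the corresponding test $\Psi_I^\star:=\Psi_{\rho_\varepsilon,I}$ satisfies $$r_\varepsilon(\mathcal E_a,\Psi_I^\star,\beta)\le\mathcal C\,\tilde r_\varepsilon .$$ -/

import Mathlib

open MeasureTheory ProbabilityTheory
open scoped ENNReal NNReal

noncomputable section

namespace SignalDetection

/-- The space of square-summable real sequences indexed by `{1, 2, …}`. -/
abbrev Signal : Type := lp (fun _ : ℕ+ => ℝ) 2

/-- `c ≍ d`: the ratios `c j / d j` stay between two positive constants, for all `j`. -/
def Comparable (c d : ℕ+ → ℝ) : Prop :=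
  ∃ κ₀ κ₁ : ℝ, 0 < κ₀ ∧ κ₀ ≤ κ₁ ∧ ∀ j, κ₀ ≤ c j / d j ∧ c j / d j ≤ κ₁

/-- The law of the sequence `Y j = b j * θ j + ε * ξ j`, where the `ξ j` are independent standard
Gaussian random variables. -/
def law (b : ℕ+ → ℝ) (ε : ℝ) (θ : Signal) : Measure (ℕ+ → ℝ) :=
  (Measure.infinitePi fun _ : ℕ+ => gaussianReal 0 1).map fun ξ j => b j * θ j + ε * ξ j

/-- The ellipsoid of square-summable `θ` with `∑ a j ^ 2 * θ j ^ 2 ≤ 1`. -/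
def ellipsoid (a : ℕ+ → ℝ) : Set Signal :=
  {θ | (Summable fun j => a j ^ 2 * θ j ^ 2) ∧ ∑' j, a j ^ 2 * θ j ^ 2 ≤ 1}

/-- The alternative: signals of the ellipsoid whose norm is at least `r`. -/
def alternative (a : ℕ+ → ℝ) (r : ℝ) : Set Signal :=
  {θ | θ ∈ ellipsoid a ∧ r ≤ ‖θ‖}

/-- The first kind error probability of `Ψ` (the value `1` means rejection of `θ = 0`). -/
def firstKindError (b : ℕ+ → ℝ) (ε : ℝ) (Ψ : (ℕ+ → ℝ) → Fin 2) : ℝ≥0∞ :=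
  law b ε 0 {y | Ψ y = 1}

/-- The maximal second kind error probability of `Ψ` over a set of signals. -/
def secondKindError (b : ℕ+ → ℝ) (ε : ℝ) (Θ : Set Signal) (Ψ : (ℕ+ → ℝ) → Fin 2) : ℝ≥0∞ :=
  ⨆ θ ∈ Θ, law b ε θ {y | Ψ y = 0}

/-- The separation radius of `Ψ` over the ellipsoid. The set is never empty when `β ≥ 0` and
`a 1 > 0`: the alternative is empty for large `r`. -/
def separationRadius (a b : ℕ+ → ℝ) (ε β : ℝ) (Ψ : (ℕ+ → ℝ) → Fin 2) : ℝ :=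
  sInf {r : ℝ | 0 < r ∧ secondKindError b ε (alternative a r) Ψ ≤ ENNReal.ofReal β}

/-- The set of `α`-level tests: measurable `{0,1}`-valued functions of the observation whose first
kind error probability is at most `α`. -/
def levelTests (b : ℕ+ → ℝ) (ε α : ℝ) : Set ((ℕ+ → ℝ) → Fin 2) :=
  {Ψ | Measurable Ψ ∧ firstKindError b ε Ψ ≤ ENNReal.ofReal α}

/-- The minimax separation radius: the infimum of the separation radii of all `α`-level tests. -/
def minimaxRadius (a b : ℕ+ → ℝ) (ε α β : ℝ) : ℝ :=
  sInf (separationRadius a b ε β '' levelTests b ε α)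

/-- The functional `θ ↦ (2 ε ^ 4)⁻¹ * ∑ b k ^ 4 * θ k ^ 4`. The series converges for every
square-summable `θ` as soon as `b` is bounded. -/
def energy (b : ℕ+ → ℝ) (ε : ℝ) (θ : Signal) : ℝ :=
  1 / (2 * ε ^ 4) * ∑' k, b k ^ 4 * θ k ^ 4

/-- `θbar` solves the extremal problem: it minimizes the functional `energy` over the
alternative of radius `r`. -/
def IsExtremal (a b : ℕ+ → ℝ) (ε r : ℝ) (θbar : Signal) : Prop :=
  θbar ∈ alternative a r ∧ ∀ θ ∈ alternative a r, energy b ε θbar ≤ energy b ε θ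

/-- The Ingster filter built on an extremal sequence `θbar`. -/
def ingsterFilter (b : ℕ+ → ℝ) (θbar : Signal) (j : ℕ+) : ℝ :=
  b j ^ 2 * θbar j ^ 2 / √(2 * ∑' k, b k ^ 4 * θbar k ^ 4)

/-- The `p`-quantile of the standard Gaussian distribution, for `0 < p < 1`. -/
def gaussianQuantile (p : ℝ) : ℝ :=
  sInf {x : ℝ | p ≤ cdf (gaussianReal 0 1) x}

/-- The test statistic `∑ ω j * ((y j / ε) ^ 2 - 1)`, with `ω` the Ingster filter. -/
def ingsterStatistic (b : ℕ+ → ℝ) (ε : ℝ) (θbar : Signal) (y : ℕ+ → ℝ) : ℝ :=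
  ∑' j, ingsterFilter b θbar j * ((y j / ε) ^ 2 - 1)

/-- The Ingster test built on `θbar`: it rejects when the statistic exceeds the
`(1 - α)`-quantile of the standard Gaussian distribution. -/
def ingsterTest (b : ℕ+ → ℝ) (ε α : ℝ) (θbar : Signal) (y : ℕ+ → ℝ) : Fin 2 :=
  if gaussianQuantile (1 - α) < ingsterStatistic b ε θbar y then 1 else 0

/-- The tuning radius: its square is the infimum over real `R ≥ 2` of
`max (C₀ * R ^ (-2 s)) (c' * ε ^ 2 * R ^ (2 t + 1 / 2))`. -/
def tuningRadius (s t C₀ c' ε : ℝ) : ℝ :=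
  √(sInf ((fun R : ℝ => max (C₀ * R ^ (-2 * s)) (c' * ε ^ 2 * R ^ (2 * t + 1 / 2))) '' Set.Ici 2))

end SignalDetection

end

namespace SignalDetection

/-! ### Change of measure on product spaces -/

/-! Set `X = ε ^ (-1 / (s + t + 1/4))`, the real number at which `X ^ (-2s) = ε ^ 2 * X ^ (2t +
1/2)`. The tuning radius and the minimax radius are both compared with `X ^ (-s)`.

Lower bound. Put `± τ` with independent uniform signs on a block of about `X` indices of order `X`.
The mixture has likelihood ratio with second moment `∏ cosh (h j ^ 2) ≤ exp (∑ h j ^ 4 / 2)`, where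
`h = b τ / ε`. If this is close to one, no level-`α` test detects the block
(`noise_real_lt_of_signedShift`, `le_minimaxRadius`). Tuning `τ` gives minimax radius at least a
constant times `X ^ (-s)` (`exists_minimaxRadius_lower_bound`).

Upper bound. In the variables `θ j ^ 2` the constraints are linear and the energy is a convex
quadratic form, so a minimizer satisfies the variational inequality `⟨θbar², θ²⟩ ≥ ⟨θbar², θbar²⟩`,
with weights `b ^ 4`, on the whole alternative (`tsum_le_tsum_mul_of_isExtremal`). Hence the Ingster
statistic, built from one signal, has a large mean at every signal of the alternative. That mean
grows by `C ^ 2` when the radius grows by `C`, and at `ρ_ε` it is bounded below by a positive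
constant (`exists_energy_lower_bound`). Chebyshev's inequality then controls the second kind error
at radius `C ρ_ε` (`law_quadratic_tsum_le`, `separationRadius_ingsterTest_le`). The first kind error
of the Ingster test plays no role in the inequality.

Minimizers exist by compactness in the product topology (`exists_isExtremal`). -/

theorem infinitePi_withDensity {ι X : Type*} [MeasurableSpace X] (μ : ι → Measure X)
    [∀ i, IsProbabilityMeasure (μ i)] (F : Finset ι) (g : ι → X → ℝ≥0∞)
    (hg : ∀ i, Measurable (g i)) (hF : ∀ i, i ∉ F → g i = 1)
    [∀ i, IsProbabilityMeasure ((μ i).withDensity (g i))] :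
    (Measure.infinitePi μ).withDensity (fun x => ∏ i ∈ F, g i (x i)) =
      Measure.infinitePi fun i => (μ i).withDensity (g i) := by
  classical
  apply Measure.eq_infinitePi
  intro s t ht
  have hbox : MeasurableSet (Set.pi (s : Set ι) t) :=
    MeasurableSet.pi s.countable_toSet fun i _ => ht i
  -- The indicator of a box factorizes, so it is absorbed into the densities; independence then
  -- applies to a single finite product.
  let G : ι → X → ℝ≥0∞ := fun i => if i ∈ s then (t i).indicator (g i) else g i
  have hG : ∀ i, Measurable (G i) := fun i => by
    by_cases h : i ∈ s
    · simpa [G, h] using (hg i).indicator (ht i)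
    · simpa [G, h] using hg i
  have key : (Set.pi (s : Set ι) t).indicator (fun x : ι → X => ∏ i ∈ F, g i (x i)) =
      fun x => ∏ i ∈ s ∪ F, G i (x i) := by
    funext x
    by_cases hx : x ∈ Set.pi (s : Set ι) t
    · rw [Set.indicator_of_mem hx]
      rw [Finset.prod_subset (Finset.subset_union_right : F ⊆ s ∪ F)
        (fun i _ hi => by rw [hF i hi]; rfl)]
      refine Finset.prod_congr rfl fun i _ => ?_
      by_cases h : i ∈ s
      · simp [G, h, Set.indicator_of_mem (hx i h)]
      · simp [G, h]
    · rw [Set.indicator_of_notMem hx]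
      simp only [Set.mem_pi, not_forall] at hx
      obtain ⟨i, hi, hit⟩ := hx
      have hi' : i ∈ s := hi
      symm
      refine Finset.prod_eq_zero (Finset.mem_union_left F hi') ?_
      simp [G, hi', Set.indicator_of_notMem hit]
  have hind := lintegral_prod_eq_prod_lintegral_of_indepFun (s ∪ F)
    (fun i (x : ι → X) => G i (x i))
    (iIndepFun_infinitePi (P := μ) hG) fun i => (hG i).comp (measurable_pi_apply i)
  rw [withDensity_apply _ hbox, ← lintegral_indicator hbox, key, hind]
  have hone : ∀ i, ∫⁻ x, G i (x i) ∂Measure.infinitePi μ = ∫⁻ x, G i x ∂μ i := fun i => by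
    rw [← Measure.infinitePi_map_eval μ i, lintegral_map (hG i) (measurable_pi_apply i)]
  have hmem : ∀ i ∈ s, ∫⁻ x, G i (x i) ∂Measure.infinitePi μ = (μ i).withDensity (g i) (t i) := by
    intro i hi
    rw [hone i, withDensity_apply _ (ht i), ← lintegral_indicator (ht i)]
    simp [G, hi]
  rw [← Finset.prod_congr rfl hmem]
  -- Coordinates of `F` outside `s` contribute the total mass of a probability measure, that is,
  -- one.
  refine (Finset.prod_subset Finset.subset_union_left fun i _ hi => ?_).symm
  rw [hone i]
  have := measure_univ (μ := (μ i).withDensity (g i))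
  rw [withDensity_apply _ .univ, Measure.restrict_univ] at this
  simpa [G, hi] using this

/-- The law of infinitely many independent standard Gaussian random variables. -/
noncomputable abbrev noise : Measure (ℕ+ → ℝ) := Measure.infinitePi fun _ : ℕ+ => gaussianReal 0 1

/-- The density of `N(h, 1)` with respect to `N(0, 1)`. -/
noncomputable def gaussianRatio (h x : ℝ) : ℝ := Real.exp (h * x - h ^ 2 / 2)

theorem measurable_gaussianRatio (h : ℝ) : Measurable (gaussianRatio h) := by
  unfold gaussianRatio; fun_prop

theorem gaussianReal_eq_withDensity (h : ℝ) :
    gaussianReal h 1 = (gaussianReal 0 1).withDensity fun x => ENNReal.ofReal (gaussianRatio h x) := by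
  rw [gaussianReal_of_var_ne_zero h one_ne_zero, gaussianReal_of_var_ne_zero 0 one_ne_zero,
    ← withDensity_mul _ (measurable_gaussianPDF 0 1) (measurable_gaussianRatio h).ennreal_ofReal]
  congr 1
  funext x
  simp only [Pi.mul_apply, gaussianPDF, gaussianPDFReal, gaussianRatio]
  rw [← ENNReal.ofReal_mul (by positivity), mul_assoc _ (Real.exp _) (Real.exp _), ← Real.exp_add]
  congr 3
  simp
  ring

/-- The Cameron–Martin formula for a finitely supported shift; the density is a finite product, so
no convergence question arises. -/
theorem noise_map_add (F : Finset ℕ+) (h : ℕ+ → ℝ) (hF : ∀ j, j ∉ F → h j = 0) :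
    noise.map (fun ξ j => h j + ξ j) =
      noise.withDensity fun ξ => ∏ j ∈ F, ENNReal.ofReal (gaussianRatio (h j) (ξ j)) := by
  have : ∀ j, IsProbabilityMeasure ((gaussianReal 0 1).withDensity
      fun x => ENNReal.ofReal (gaussianRatio (h j) x)) := fun j => by
    rw [← gaussianReal_eq_withDensity]; infer_instance
  rw [infinitePi_withDensity (fun _ : ℕ+ => gaussianReal 0 1) F
    (fun j x => ENNReal.ofReal (gaussianRatio (h j) x))
    (fun j => (measurable_gaussianRatio _).ennreal_ofReal)
    (fun j hj => by funext x; simp [gaussianRatio, hF j hj]),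
    Measure.infinitePi_map_pi (f := fun j x => h j + x) _ fun j => by fun_prop]
  congr 1
  funext j
  rw [gaussianReal_map_const_add, zero_add, ← gaussianReal_eq_withDensity]

/-! ### Random-sign mixtures and their second moment -/

/-- The density of the symmetric mixture of `N(h, 1)` and `N(-h, 1)` with respect to `N(0, 1)`. -/
noncomputable def mixtureRatio (h x : ℝ) : ℝ := (gaussianRatio h x + gaussianRatio (-h) x) / 2

theorem measurable_mixtureRatio (h : ℝ) : Measurable (mixtureRatio h) :=
  ((measurable_gaussianRatio h).add (measurable_gaussianRatio (-h))).div_const 2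

theorem mixtureRatio_nonneg (h x : ℝ) : 0 ≤ mixtureRatio h x := by
  unfold mixtureRatio gaussianRatio; positivity

theorem integral_exp_mul_gaussianReal (t : ℝ) :
    ∫ x, Real.exp (t * x) ∂gaussianReal 0 1 = Real.exp (t ^ 2 / 2) := by
  have := congrFun (mgf_fun_id_gaussianReal (μ := 0) (v := 1)) t
  simpa [mgf] using this

theorem mixtureRatio_eq (h x : ℝ) : mixtureRatio h x =
    Real.exp (-h ^ 2 / 2) / 2 * Real.exp (h * x) + Real.exp (-h ^ 2 / 2) / 2 * Real.exp (-h * x) := by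
  unfold mixtureRatio gaussianRatio
  rw [show h * x - h ^ 2 / 2 = -h ^ 2 / 2 + h * x by ring,
    show -h * x - (-h) ^ 2 / 2 = -h ^ 2 / 2 + -h * x by ring, Real.exp_add, Real.exp_add]
  ring

theorem mixtureRatio_sq (h x : ℝ) : mixtureRatio h x ^ 2 =
    Real.exp (-h ^ 2) / 4 * Real.exp (2 * h * x) + Real.exp (-h ^ 2) / 4 * Real.exp (-(2 * h) * x)
      + Real.exp (-h ^ 2) / 2 := by
  rw [mixtureRatio_eq]
  have e1 : Real.exp (-h ^ 2) = Real.exp (-h ^ 2 / 2) ^ 2 := by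
    rw [← Real.exp_nat_mul]; congr 1; push_cast; ring
  have e2 : Real.exp (2 * h * x) = Real.exp (h * x) ^ 2 := by
    rw [← Real.exp_nat_mul]; congr 1; push_cast; ring
  have e3 : Real.exp (-(2 * h) * x) = Real.exp (-h * x) ^ 2 := by
    rw [← Real.exp_nat_mul]; congr 1; push_cast; ring
  have e4 : Real.exp (h * x) * Real.exp (-h * x) = 1 := by
    rw [← Real.exp_add, ← Real.exp_zero]; congr 1; ring
  rw [e1, e2, e3]
  linear_combination Real.exp (-h ^ 2 / 2) ^ 2 / 2 * e4

theorem lintegral_mixtureRatio (h : ℝ) :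
    ∫⁻ x, ENNReal.ofReal (mixtureRatio h x) ∂gaussianReal 0 1 = 1 := by
  have i1 := integrable_exp_mul_gaussianReal (μ := 0) (v := 1) h
  have i2 := integrable_exp_mul_gaussianReal (μ := 0) (v := 1) (-h)
  have hint : Integrable (mixtureRatio h) (gaussianReal 0 1) := by
    rw [funext (mixtureRatio_eq h)]
    exact (i1.const_mul _).add (i2.const_mul _)
  rw [← ofReal_integral_eq_lintegral_ofReal hint (.of_forall (mixtureRatio_nonneg h)),
    funext (mixtureRatio_eq h), integral_add (i1.const_mul _) (i2.const_mul _),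
    integral_const_mul, integral_const_mul, integral_exp_mul_gaussianReal,
    integral_exp_mul_gaussianReal, ← ENNReal.ofReal_one, neg_sq, neg_div, Real.exp_neg]
  congr 1
  field_simp
  norm_num

/-- Symmetrizing the sign cancels the term of order `h ^ 2`: a single shift would give `exp (h ^
2)`, the mixture only `1 + O(h ^ 4)`. This is why detection is governed by a sum of fourth powers.
-/
theorem lintegral_mixtureRatio_sq (h : ℝ) :
    ∫⁻ x, ENNReal.ofReal (mixtureRatio h x ^ 2) ∂gaussianReal 0 1 =
      ENNReal.ofReal (Real.cosh (h ^ 2)) := by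
  have i1 := integrable_exp_mul_gaussianReal (μ := 0) (v := 1) (2 * h)
  have i2 := integrable_exp_mul_gaussianReal (μ := 0) (v := 1) (-(2 * h))
  have i3 : Integrable (fun x => Real.exp (-h ^ 2) / 4 * Real.exp (2 * h * x)
      + Real.exp (-h ^ 2) / 4 * Real.exp (-(2 * h) * x)) (gaussianReal 0 1) := (i1.const_mul (Real.exp (-h ^ 2) / 4)).add (i2.const_mul (Real.exp (-h ^ 2) / 4))
  have i4 : Integrable (fun _ : ℝ => Real.exp (-h ^ 2) / 2) (gaussianReal 0 1) :=
    integrable_const _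
  have hint : Integrable (fun x => mixtureRatio h x ^ 2) (gaussianReal 0 1) := by
    rw [funext (mixtureRatio_sq h)]
    exact i3.add i4
  rw [← ofReal_integral_eq_lintegral_ofReal hint (.of_forall fun x => sq_nonneg _),
    funext (mixtureRatio_sq h), integral_add i3 i4,
    integral_add (i1.const_mul _) (i2.const_mul _),
    integral_const_mul, integral_const_mul, integral_exp_mul_gaussianReal,
    integral_exp_mul_gaussianReal, Real.cosh_eq]
  congr 1
  simp only [neg_sq, integral_const, probReal_univ, one_smul]
  have : Real.exp (-h ^ 2) * Real.exp ((2 * h) ^ 2 / 2) = Real.exp (h ^ 2) := by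
    rw [← Real.exp_add]; congr 1; ring
  linear_combination this / 2

theorem lintegral_noise_prod (F : Finset ℕ+) (g : ℕ+ → ℝ → ℝ≥0∞) (hg : ∀ j, Measurable (g j)) :
    ∫⁻ ξ, ∏ j ∈ F, g j (ξ j) ∂noise = ∏ j ∈ F, ∫⁻ x, g j x ∂gaussianReal 0 1 := by
  rw [lintegral_prod_eq_prod_lintegral_of_indepFun F (fun j (ξ : ℕ+ → ℝ) => g j (ξ j))
    (iIndepFun_infinitePi hg) fun j => (hg j).comp (measurable_pi_apply j)]
  refine Finset.prod_congr rfl fun j _ => ?_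
  exact (lintegral_map (hg j) (measurable_pi_apply j)).symm.trans
    (by rw [Measure.infinitePi_map_eval])

/-- The signal `h` on `F`, with its signs reversed off `t`. -/
noncomputable def signedShift (F t : Finset ℕ+) (h : ℕ+ → ℝ) (j : ℕ+) : ℝ :=
  if j ∈ F then if j ∈ t then h j else -h j else 0

/-- Expanding the product of two-term averages turns the mixture density into the uniform average
over all sign patterns on `F`, indexed by the set `t` of positive signs. -/
theorem prod_mixtureRatio (F : Finset ℕ+) (h : ℕ+ → ℝ) (ξ : ℕ+ → ℝ) :
    ENNReal.ofReal (∏ j ∈ F, mixtureRatio (h j) (ξ j)) =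
      ∑ t ∈ F.powerset, (2⁻¹ : ℝ≥0∞) ^ F.card *
        ∏ j ∈ F, ENNReal.ofReal (gaussianRatio (signedShift F t h j) (ξ j)) := by
  have hr : ∀ h x, 0 ≤ gaussianRatio h x := fun h x => (Real.exp_pos _).le
  rw [ENNReal.ofReal_prod_of_nonneg fun j _ => mixtureRatio_nonneg _ _]
  have e : ∀ j ∈ F, ENNReal.ofReal (mixtureRatio (h j) (ξ j)) =
      2⁻¹ * (ENNReal.ofReal (gaussianRatio (h j) (ξ j))
        + ENNReal.ofReal (gaussianRatio (-h j) (ξ j))) := fun j _ => by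
    rw [mixtureRatio, ENNReal.ofReal_div_of_pos two_pos, ENNReal.ofReal_add (hr _ _) (hr _ _),
      ENNReal.div_eq_inv_mul]
    simp
  rw [Finset.prod_congr rfl e, Finset.prod_mul_distrib, Finset.prod_const, Finset.prod_add,
    Finset.mul_sum]
  refine Finset.sum_congr rfl fun t ht => ?_
  have htF := Finset.mem_powerset.1 ht
  congr 1
  rw [← Finset.prod_sdiff htF, mul_comm]
  congr 1
  · refine Finset.prod_congr rfl fun j hj => ?_
    rw [Finset.mem_sdiff] at hj
    simp [signedShift, hj.1, hj.2]
  · refine Finset.prod_congr rfl fun j hj => ?_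
    simp [signedShift, htF hj, hj]

/-- Le Cam's lower bound for a prior made of independent random signs: an event that has small
probability under every signed shift of the noise cannot have large probability. -/
theorem noise_real_lt_of_signedShift (F : Finset ℕ+) (h : ℕ+ → ℝ) {A : Set (ℕ+ → ℝ)}
    (hA : MeasurableSet A) {β δ : ℝ} (hβ : 0 ≤ β) (hδ : 0 < δ)
    (hshift : ∀ t ∈ F.powerset, noise.map (fun ξ j => signedShift F t h j + ξ j) A ≤
      ENNReal.ofReal β)
    (hχ : Real.exp ((∑ j ∈ F, h j ^ 4) / 2) - 1 < δ ^ 2) :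
    noise.real A < β + δ := by
  set M : (ℕ+ → ℝ) → ℝ := fun ξ => ∏ j ∈ F, mixtureRatio (h j) (ξ j) with hMdef
  have hM0 : ∀ ξ, 0 ≤ M ξ := fun ξ => Finset.prod_nonneg fun j _ => mixtureRatio_nonneg _ _
  have hMm : Measurable M :=
    Finset.measurable_fun_prod _ fun j _ => (measurable_mixtureRatio _).comp (measurable_pi_apply j)
  have hA1 : ∫⁻ ξ in A, ENNReal.ofReal (M ξ) ∂noise ≤ ENNReal.ofReal β := by
    simp only [hMdef, prod_mixtureRatio]
    rw [lintegral_finsetSum]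
    · calc _ ≤ ∑ t ∈ F.powerset, (2⁻¹ : ℝ≥0∞) ^ F.card * ENNReal.ofReal β := by
            refine Finset.sum_le_sum fun t ht => ?_
            rw [lintegral_const_mul]
            · gcongr
              rw [← withDensity_apply _ hA, ← noise_map_add F _ fun j hj => by
                simp [signedShift, hj]]
              exact hshift t ht
            · exact Finset.measurable_fun_prod _ fun j _ =>
                ((measurable_gaussianRatio _).comp (measurable_pi_apply j)).ennreal_ofReal
        _ = ENNReal.ofReal β := by
            rw [Finset.sum_const, Finset.card_powerset, nsmul_eq_mul, ← mul_assoc]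
            push_cast
            rw [← mul_pow, ENNReal.mul_inv_cancel two_ne_zero ENNReal.ofNat_ne_top, one_pow,
              one_mul]
    · intro t _
      exact (Finset.measurable_fun_prod _ fun j _ =>
        ((measurable_gaussianRatio _).comp (measurable_pi_apply j)).ennreal_ofReal).const_mul _
  have hM1 : ∫⁻ ξ, ENNReal.ofReal (M ξ) ∂noise = 1 := by
    simp only [hMdef, ENNReal.ofReal_prod_of_nonneg fun j _ => mixtureRatio_nonneg _ _]
    rw [lintegral_noise_prod F (fun j x => ENNReal.ofReal (mixtureRatio (h j) x))
      fun j => (measurable_mixtureRatio _).ennreal_ofReal]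
    simp [lintegral_mixtureRatio]
  have hM2 : ∫⁻ ξ, ENNReal.ofReal (M ξ ^ 2) ∂noise =
      ENNReal.ofReal (∏ j ∈ F, Real.cosh (h j ^ 2)) := by
    simp only [hMdef, ← Finset.prod_pow,
      ENNReal.ofReal_prod_of_nonneg fun j _ => sq_nonneg (mixtureRatio _ _)]
    rw [lintegral_noise_prod F (fun j x => ENNReal.ofReal (mixtureRatio (h j) x ^ 2))
      fun j => ((measurable_mixtureRatio _).pow_const 2).ennreal_ofReal,
      ENNReal.ofReal_prod_of_nonneg fun j _ => (Real.cosh_pos _).le]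
    simp [lintegral_mixtureRatio_sq]
  have hI1 : Integrable M noise :=
    ⟨hMm.aestronglyMeasurable, by
      rw [hasFiniteIntegral_iff_ofReal (.of_forall hM0), hM1]; exact ENNReal.one_lt_top⟩
  have hI2 : Integrable (fun ξ => M ξ ^ 2) noise :=
    ⟨(hMm.pow_const 2).aestronglyMeasurable, by
      rw [hasFiniteIntegral_iff_ofReal (.of_forall fun ξ => sq_nonneg _), hM2]
      exact ENNReal.ofReal_lt_top⟩
  have hE1 : ∫ ξ, M ξ ∂noise = 1 := by
    rw [integral_eq_lintegral_of_nonneg_ae (.of_forall hM0) hI1.1, hM1, ENNReal.toReal_one]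
  have hE2 : ∫ ξ, M ξ ^ 2 ∂noise ≤ Real.exp ((∑ j ∈ F, h j ^ 4) / 2) := by
    rw [integral_eq_lintegral_of_nonneg_ae (.of_forall fun ξ => sq_nonneg _) hI2.1, hM2,
      ENNReal.toReal_ofReal (Finset.prod_nonneg fun j _ => (Real.cosh_pos _).le),
      Finset.sum_div, Real.exp_sum]
    -- The bound `cosh x ≤ exp (x ^ 2 / 2)` at `x = h j ^ 2`.
    refine Finset.prod_le_prod (fun j _ => (Real.cosh_pos _).le) fun j _ => ?_
    refine (Real.cosh_le_exp_half_sq _).trans_eq ?_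
    congr 1; ring
  have hAr : ∫ ξ in A, M ξ ∂noise ≤ β := by
    rw [integral_eq_lintegral_of_nonneg_ae (.of_forall hM0) hI1.1.restrict]
    exact ENNReal.toReal_le_of_le_ofReal hβ hA1
  have hsq : Integrable (fun ξ => (1 - M ξ) ^ 2) noise := by
    have : (fun ξ => (1 - M ξ) ^ 2) = fun ξ => 1 - 2 * M ξ + M ξ ^ 2 := by funext ξ; ring
    rw [this]
    exact ((integrable_const _).sub (hI1.const_mul 2)).add hI2
  have hEsq : ∫ ξ, (1 - M ξ) ^ 2 ∂noise < δ ^ 2 := by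
    have : (fun ξ => (1 - M ξ) ^ 2) = fun ξ => 1 - 2 * M ξ + M ξ ^ 2 := by funext ξ; ring
    rw [this, integral_add (f := fun ξ => 1 - 2 * M ξ) ((integrable_const _).sub (hI1.const_mul 2)) hI2,
      integral_sub (integrable_const _) (hI1.const_mul 2), integral_const_mul, hE1]
    simp only [integral_const, probReal_univ, one_smul]
    linarith
  have hdom : Integrable (fun ξ => δ / 2 + (1 - M ξ) ^ 2 / (2 * δ)) noise :=
    (integrable_const _).add (hsq.div_const _)
  -- The inequality `u ≤ δ/2 + u ^ 2 / (2δ)` replaces Cauchy–Schwarz: the integral of `1 - M` over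
  -- `A` is then less than `δ/2 + δ/2`.
  have hpt : ∀ ξ, 1 - M ξ ≤ δ / 2 + (1 - M ξ) ^ 2 / (2 * δ) := fun ξ => by
    have : δ / 2 + (1 - M ξ) ^ 2 / (2 * δ) - (1 - M ξ) = (1 - M ξ - δ) ^ 2 / (2 * δ) := by
      field_simp; ring
    have : 0 ≤ (1 - M ξ - δ) ^ 2 / (2 * δ) := by positivity
    linarith
  have hle : ∫ ξ in A, (1 - M ξ) ∂noise ≤ ∫ ξ, (δ / 2 + (1 - M ξ) ^ 2 / (2 * δ)) ∂noise :=
    (setIntegral_mono (((integrable_const _).sub hI1).integrableOn) hdom.integrableOn hpt).trans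
      (setIntegral_le_integral hdom (.of_forall fun ξ => by positivity))
  rw [integral_sub (integrable_const _).integrableOn hI1.integrableOn,
    integral_add (integrable_const _) (hsq.div_const _)] at hle
  simp only [integral_const, measureReal_restrict_apply_univ, probReal_univ, smul_eq_mul, mul_one,
    one_mul] at hle
  rw [integral_div (2 * δ)] at hle
  have : (∫ ξ, (1 - M ξ) ^ 2 ∂noise) / (2 * δ) < δ / 2 := by
    rw [div_lt_iff₀ (by positivity)]
    nlinarith
  linarith


/-! ### Deviations of quadratic statistics -/

theorem integrable_pow_gaussianReal (n : ℕ) :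
    Integrable (fun x : ℝ => x ^ n) (gaussianReal 0 1) := by
  have h := (memLp_id_gaussianReal (μ := 0) (v := 1) (n : ℝ≥0)).integrable_norm_pow'
  refine (integrable_norm_iff (by fun_prop)).1 ?_
  simpa [norm_pow] using h

/-- The fourth moment of the standard Gaussian distribution. -/
noncomputable def gaussianFourthMoment : ℝ := ∫ x, x ^ 4 ∂gaussianReal 0 1

theorem gaussianFourthMoment_nonneg : 0 ≤ gaussianFourthMoment :=
  integral_nonneg fun x => by positivity

theorem integral_sq_gaussianReal : ∫ x, x ^ 2 ∂gaussianReal 0 1 = 1 := by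
  have h := variance_eq_sub (μ := gaussianReal 0 1) (X := id)
    (memLp_id_gaussianReal' 2 ENNReal.ofNat_ne_top)
  rw [variance_id_gaussianReal] at h
  simpa [integral_id_gaussianReal] using h.symm

theorem integrable_shift_sq (m : ℝ) : Integrable (fun x : ℝ => (m + x) ^ 2) (gaussianReal 0 1) := by
  have : (fun x : ℝ => (m + x) ^ 2) = fun x => m ^ 2 + 2 * m * x ^ 1 + x ^ 2 := by
    funext x; ring
  rw [this]
  exact ((integrable_const _).add ((integrable_pow_gaussianReal 1).const_mul _)).add
    (integrable_pow_gaussianReal 2)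

theorem integral_shift_sq (m : ℝ) : ∫ x, (m + x) ^ 2 ∂gaussianReal 0 1 = m ^ 2 + 1 := by
  have : (fun x : ℝ => (m + x) ^ 2) = fun x => m ^ 2 + 2 * m * x ^ 1 + x ^ 2 := by
    funext x; ring
  have h1 := (integrable_pow_gaussianReal 1).const_mul (2 * m)
  rw [this, integral_add (f := fun x => m ^ 2 + 2 * m * x ^ 1) ((integrable_const _).add h1)
    (integrable_pow_gaussianReal 2), integral_add (integrable_const _) h1, integral_const_mul,
    integral_sq_gaussianReal]
  have : ∫ x : ℝ, x ^ 1 ∂gaussianReal 0 1 = 0 := by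
    simp
  rw [this]
  simp

/-- One summand of a centred quadratic statistic, as a function of the noise: `w` is the weight
and `m` the mean of the observation. -/
noncomputable def quadraticTerm (w m x : ℝ) : ℝ := w * ((m + x) ^ 2 - 1)

theorem measurable_quadraticTerm (w m : ℝ) : Measurable (quadraticTerm w m) := by
  unfold quadraticTerm; fun_prop

theorem integral_quadraticTerm (w m : ℝ) :
    ∫ x, quadraticTerm w m x ∂gaussianReal 0 1 = w * m ^ 2 := by
  unfold quadraticTerm
  rw [integral_const_mul, integral_sub (integrable_shift_sq m) (integrable_const _),
    integral_shift_sq]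
  simp

theorem memLp_quadraticTerm (w m : ℝ) : MemLp (quadraticTerm w m) 2 (gaussianReal 0 1) := by
  rw [memLp_two_iff_integrable_sq (measurable_quadraticTerm w m).aestronglyMeasurable]
  have : (fun x => quadraticTerm w m x ^ 2) = fun x =>
      w ^ 2 * x ^ 4 + 4 * m * w ^ 2 * x ^ 3 + w ^ 2 * (6 * m ^ 2 - 2) * x ^ 2
        + w ^ 2 * (4 * m ^ 3 - 4 * m) * x ^ 1 + w ^ 2 * (m ^ 2 - 1) ^ 2 := by
    funext x; unfold quadraticTerm; ring
  rw [this]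
  have h := fun n => (integrable_pow_gaussianReal n)
  exact ((((((h 4).const_mul _).add ((h 3).const_mul _)).add ((h 2).const_mul _)).add
    ((h 1).const_mul _)).add (integrable_const _))

/-- Drop the constant, bound the variance by the second moment and use `(x ^ 2 + 2 m x) ^ 2 ≤ 2 x ^
4 + 8 m ^ 2 x ^ 2`. The exact value of the fourth moment is never needed. -/
theorem variance_quadraticTerm_le (w m : ℝ) :
    variance (quadraticTerm w m) (gaussianReal 0 1) ≤
      w ^ 2 * (2 * gaussianFourthMoment + 8 * m ^ 2) := by
  have e : quadraticTerm w m = fun x => w * (x ^ 2 + 2 * m * x) + w * (m ^ 2 - 1) := by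
    funext x; unfold quadraticTerm; ring
  have hm : AEStronglyMeasurable (fun x : ℝ => w * (x ^ 2 + 2 * m * x)) (gaussianReal 0 1) := by
    fun_prop
  have i4 := (integrable_pow_gaussianReal 4).const_mul (2 * w ^ 2)
  have i2 := (integrable_pow_gaussianReal 2).const_mul (8 * w ^ 2 * m ^ 2)
  rw [e, variance_add_const hm]
  refine (variance_le_expectation_sq hm).trans ?_
  calc ∫ x, ((fun x : ℝ => w * (x ^ 2 + 2 * m * x)) ^ 2) x ∂gaussianReal 0 1
      ≤ ∫ x, (2 * w ^ 2 * x ^ 4 + 8 * w ^ 2 * m ^ 2 * x ^ 2) ∂gaussianReal 0 1 := by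
        refine integral_mono_of_nonneg (.of_forall fun x => sq_nonneg _) (i4.add i2)
          (.of_forall fun x => ?_)
        simp only [Pi.pow_apply]
        nlinarith [sq_nonneg (w * (x ^ 2 - 2 * m * x))]
    _ = w ^ 2 * (2 * gaussianFourthMoment + 8 * m ^ 2) := by
        rw [integral_add i4 i2, integral_const_mul, integral_const_mul, integral_sq_gaussianReal,
          gaussianFourthMoment]
        ring

theorem measurePreserving_coordinate (j : ℕ+) :
    MeasurePreserving (fun ξ : ℕ+ → ℝ => ξ j) noise (gaussianReal 0 1) :=
  measurePreserving_eval_infinitePi (fun _ : ℕ+ => gaussianReal 0 1) j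

/-- Chebyshev's inequality for a finite quadratic statistic whose mean `∑ w j * m j ^ 2` is
large. -/
theorem noise_quadratic_sum_le (s : Finset ℕ+) (w m : ℕ+ → ℝ) (hw0 : ∀ j, 0 ≤ w j)
    (hw2 : ∑ j ∈ s, w j ^ 2 ≤ 1) {q β : ℝ} (hβ : 0 < β)
    (hM : 2 * (|q| + 1) + (8 * gaussianFourthMoment + 32) / β ≤ ∑ j ∈ s, w j * m j ^ 2) :
    noise {ξ | ∑ j ∈ s, quadraticTerm (w j) (m j) (ξ j) ≤ q} ≤ ENNReal.ofReal β := by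
  set E := ∑ j ∈ s, w j * m j ^ 2 with hE
  set Z : ℕ+ → (ℕ+ → ℝ) → ℝ := fun j ξ => quadraticTerm (w j) (m j) (ξ j) with hZ
  have hK := gaussianFourthMoment_nonneg
  have hfrac : 0 ≤ (8 * gaussianFourthMoment + 32) / β := by positivity
  have hZL : ∀ j, MemLp (Z j) 2 noise := fun j =>
    (memLp_quadraticTerm (w j) (m j)).comp_measurePreserving (measurePreserving_coordinate j)
  have hind : iIndepFun Z noise := iIndepFun_infinitePi fun j => measurable_quadraticTerm _ _
  have hZE : ∀ j, ∫ ξ, Z j ξ ∂noise = w j * m j ^ 2 := fun j => by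
    rw [← integral_quadraticTerm, ← (measurePreserving_coordinate j).map_eq,
      integral_map (measurable_pi_apply j).aemeasurable
        (measurable_quadraticTerm _ _).aestronglyMeasurable]
  have hZV : ∀ j, variance (Z j) noise ≤ w j ^ 2 * (2 * gaussianFourthMoment + 8 * m j ^ 2) :=
    fun j => by
      refine le_trans (le_of_eq ?_) (variance_quadraticTerm_le (w j) (m j))
      rw [← (measurePreserving_coordinate j).map_eq,
        variance_map (measurable_quadraticTerm _ _).aemeasurable
          (measurable_pi_apply j).aemeasurable]
      rfl
  -- Since each weight is at most one, the part of the variance due to the signal is at most `8 E`,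
  -- linear in the mean, whereas Chebyshev divides by its square.
  have hw1 : ∀ j ∈ s, w j ^ 2 ≤ w j := fun j hj => by
    have h1 : w j ^ 2 ≤ 1 :=
      (Finset.single_le_sum (f := fun j => w j ^ 2) (fun i _ => sq_nonneg _) hj).trans hw2
    have h2 : w j ≤ 1 := by nlinarith [hw0 j]
    nlinarith [hw0 j]
  have hV : variance (∑ j ∈ s, Z j) noise ≤ 2 * gaussianFourthMoment + 8 * E := by
    rw [IndepFun.variance_sum (fun j _ => hZL j) fun i _ j _ hij => hind.indepFun hij]
    calc ∑ j ∈ s, variance (Z j) noise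
        ≤ ∑ j ∈ s, (2 * gaussianFourthMoment * w j ^ 2 + 8 * (w j * m j ^ 2)) := by
          refine Finset.sum_le_sum fun j hj => (hZV j).trans ?_
          nlinarith [mul_le_mul_of_nonneg_right (hw1 j hj) (sq_nonneg (m j))]
      _ = 2 * gaussianFourthMoment * ∑ j ∈ s, w j ^ 2 + 8 * E := by
          rw [Finset.sum_add_distrib, ← Finset.mul_sum, ← Finset.mul_sum]
      _ ≤ _ := by nlinarith
  have hmean : ∫ ξ, (∑ j ∈ s, Z j) ξ ∂noise = E := by
    simp only [Finset.sum_apply]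
    rw [integral_finsetSum _ fun j _ => (hZL j).integrable one_le_two]
    simp only [hZE, hE]
  have hL : MemLp (∑ j ∈ s, Z j) 2 noise := memLp_finsetSum' s fun j _ => hZL j
  have hq := le_abs_self q
  have hq0 := abs_nonneg q
  have hE0 : 0 < E := by linarith
  -- Chebyshev at distance `E / 2`: the bound `4 (2K + 8E) / E ^ 2`, with `K` the fourth moment, is
  -- at most `β` because `E ≥ 1` and `8K + 32 ≤ β E`.
  have hgap : E / 2 ≤ E - q := by linarith
  refine le_trans (measure_mono fun ξ hξ => ?_)
    ((meas_ge_le_variance_div_sq hL (half_pos hE0)).trans (ENNReal.ofReal_le_ofReal ?_))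
  · simp only [Set.mem_ofPred_eq] at hξ ⊢
    rw [hmean, Finset.sum_apply, abs_sub_comm]
    exact (hgap.trans (sub_le_sub_left hξ E)).trans (le_abs_self _)
  · rw [div_le_iff₀ (by positivity)]
    have h1 : 8 * gaussianFourthMoment + 32 ≤ β * E := by
      have : (8 * gaussianFourthMoment + 32) / β ≤ E := by linarith
      rwa [div_le_iff₀ hβ, mul_comm E] at this
    have h2 : 1 ≤ E := by linarith
    nlinarith [mul_le_mul_of_nonneg_right h1 hE0.le]

theorem measurable_observation (b : ℕ+ → ℝ) (ε : ℝ) (θ : Signal) :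
    Measurable fun (ξ : ℕ+ → ℝ) (j : ℕ+) => b j * θ j + ε * ξ j := by
  fun_prop

instance (b : ℕ+ → ℝ) (ε : ℝ) (θ : Signal) : IsProbabilityMeasure (law b ε θ) :=
  Measure.isProbabilityMeasure_map (measurable_observation b ε θ).aemeasurable

/-- The uncentred nonnegative series has finite expectation, so it converges almost surely;
subtracting the summable weights keeps convergence. Without it the `tsum` in the statistic could
take its default value zero. -/
theorem ae_summable_quadratic (b : ℕ+ → ℝ) {ε : ℝ} (hε : 0 < ε) (θ : Signal) (w : ℕ+ → ℝ)
    (hw0 : ∀ j, 0 ≤ w j) (hw : Summable w) (hm : Summable fun j => w j * (b j * θ j / ε) ^ 2) :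
    ∀ᵐ y ∂law b ε θ, Summable fun j => w j * ((y j / ε) ^ 2 - 1) := by
  have hmeas : ∀ j, Measurable fun y : ℕ+ → ℝ => ENNReal.ofReal (w j * (y j / ε) ^ 2) := fun j => by
    fun_prop
  have hone : ∀ j, ∫⁻ y, ENNReal.ofReal (w j * (y j / ε) ^ 2) ∂law b ε θ =
      ENNReal.ofReal (w j * (b j * θ j / ε) ^ 2 + w j) := fun j => by
    rw [law, lintegral_map (hmeas j) (measurable_observation b ε θ)]
    have e : ∀ ξ : ℕ+ → ℝ, ENNReal.ofReal (w j * ((b j * θ j + ε * ξ j) / ε) ^ 2) =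
        (fun x => ENNReal.ofReal (w j * (b j * θ j / ε + x) ^ 2)) (ξ j) := fun ξ => by
      simp only
      congr 3
      field_simp
    rw [lintegral_congr e]
    refine ((measurePreserving_coordinate j).lintegral_comp
      (f := fun x => ENNReal.ofReal (w j * (b j * θ j / ε + x) ^ 2)) (by fun_prop)).trans ?_
    rw [← ofReal_integral_eq_lintegral_ofReal ((integrable_shift_sq _).const_mul _)
        (.of_forall fun x => mul_nonneg (hw0 j) (sq_nonneg _)),
      integral_const_mul, integral_shift_sq]
    congr 1; ring
  have hfin : ∫⁻ y, ∑' j, ENNReal.ofReal (w j * (y j / ε) ^ 2) ∂law b ε θ ≠ ∞ := by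
    rw [lintegral_tsum fun j => (hmeas j).aemeasurable]
    simp only [hone]
    exact (hm.add hw).tsum_ofReal_ne_top
  filter_upwards [ae_lt_top (Measurable.tsum hmeas) hfin] with y hy
  have h := ENNReal.summable_toReal hy.ne
  have e : (fun j => w j * ((y j / ε) ^ 2 - 1)) =
      fun j => (ENNReal.ofReal (w j * (y j / ε) ^ 2)).toReal - w j := by
    funext j
    rw [ENNReal.toReal_ofReal (mul_nonneg (hw0 j) (sq_nonneg _))]
    ring
  rw [e]
  exact h.sub hw

/-- The infinite quadratic statistic rarely stays below `q` when its mean is large. -/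
theorem law_quadratic_tsum_le (b : ℕ+ → ℝ) {ε : ℝ} (hε : 0 < ε) (θ : Signal) (w : ℕ+ → ℝ)
    (hw0 : ∀ j, 0 ≤ w j) (hw : Summable w) (hw2 : ∀ s : Finset ℕ+, ∑ j ∈ s, w j ^ 2 ≤ 1)
    (hm : Summable fun j => w j * (b j * θ j / ε) ^ 2) {q β : ℝ} (hβ : 0 < β)
    (hM : 2 * (|q + 1| + 1) + (8 * gaussianFourthMoment + 32) / β <
      ∑' j, w j * (b j * θ j / ε) ^ 2) :
    law b ε θ {y | ∑' j, w j * ((y j / ε) ^ 2 - 1) ≤ q} ≤ ENNReal.ofReal β := by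
  obtain ⟨s, hs⟩ := Filter.exists_seq_tendsto (Filter.atTop : Filter (Finset ℕ+))
  set T : ℕ → (ℕ+ → ℝ) → ℝ := fun n y => ∑ j ∈ s n, w j * ((y j / ε) ^ 2 - 1) with hT
  have hTm : ∀ n, Measurable (T n) := fun n => by
    simp only [hT]; fun_prop
  have hae : ∀ᵐ y ∂law b ε θ, Filter.Tendsto (fun n => T n y) Filter.atTop
      (nhds (∑' j, w j * ((y j / ε) ^ 2 - 1))) := by
    filter_upwards [ae_summable_quadratic b hε θ w hw0 hw hm] with y hy
    exact hy.hasSum.comp hs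
  -- Almost sure convergence gives convergence in probability. A limit at most `q` with a partial
  -- sum above `q + 1` is a deviation of at least one, which costs a vanishing probability; hence
  -- the threshold `q + 1` in `hM`.
  have hmeas := tendstoInMeasure_of_tendsto_ae (fun n => (hTm n).aestronglyMeasurable) hae 1
    one_pos
  have hmean := (hm.hasSum.comp hs).eventually (lt_mem_nhds hM)
  have hlim : Filter.Tendsto (fun n => ENNReal.ofReal β + law b ε θ
      {y | 1 ≤ edist (T n y) (∑' j, w j * ((y j / ε) ^ 2 - 1))}) Filter.atTop
      (nhds (ENNReal.ofReal β + 0)) := hmeas.const_add _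
  rw [add_zero] at hlim
  refine ge_of_tendsto hlim ?_
  filter_upwards [hmean] with n hn
  have hn1 : law b ε θ {y | T n y ≤ q + 1} ≤ ENNReal.ofReal β := by
    rw [law, Measure.map_apply (measurable_observation b ε θ)
      (measurableSet_le (hTm n) measurable_const)]
    refine le_trans (le_of_eq ?_) (noise_quadratic_sum_le (s n) w (fun j => b j * θ j / ε)
      hw0 (hw2 _) hβ hn.le)
    congr 1
    ext ξ
    have : ∀ j, (b j * θ j + ε * ξ j) / ε = b j * θ j / ε + ξ j := fun j => by field_simp
    simp [hT, quadraticTerm, this]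
  refine le_trans ?_ (add_le_add_left hn1 _)
  refine le_trans (measure_mono fun y hy => ?_) (measure_union_le _ _)
  by_cases h : T n y ≤ q + 1
  · exact Or.inl h
  · right
    simp only [Set.mem_ofPred_eq] at hy ⊢
    rw [edist_dist, Real.dist_eq, ← ENNReal.ofReal_one]
    refine ENNReal.ofReal_le_ofReal ((le_abs_self _).trans' ?_)
    linarith


/-! ### Existence and geometry of the extremal sequence -/

theorem hasSum_congr_term {f g : ℕ+ → ℝ} {c : ℝ} (h : ∀ j, f j = g j) :
    HasSum f c ↔ HasSum g c := by
  rw [funext h]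

theorem hasSum_sq (θ : Signal) : HasSum (fun j => θ j ^ 2) (‖θ‖ ^ 2) := by
  have h := lp.hasSum_inner (𝕜 := ℝ) θ θ
  rw [real_inner_self_eq_norm_sq] at h
  simpa [pow_two] using h

theorem sq_le_norm_sq (θ : Signal) (j : ℕ+) : θ j ^ 2 ≤ ‖θ‖ ^ 2 :=
  le_hasSum (hasSum_sq θ) j fun _ _ => sq_nonneg _

/-- The signal with prescribed square-summable coefficients. -/
noncomputable def ofSummable (x : ℕ+ → ℝ) (hx : Summable fun j => x j ^ 2) : Signal :=
  ⟨x, (memℓp_gen_iff (by norm_num)).2 (by simpa using hx)⟩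

theorem ofSummable_apply (x : ℕ+ → ℝ) (hx : Summable fun j => x j ^ 2) (j : ℕ+) :
    ofSummable x hx j = x j := rfl

theorem summable_of_le_one {a : ℕ+ → ℝ} (ha : ∀ j, 0 < a j) (ha_mono : Monotone a) {x : ℕ+ → ℝ}
    (hx : Summable fun j => a j ^ 2 * x j ^ 2) : Summable fun j => x j ^ 2 := by
  refine Summable.of_nonneg_of_le (fun j => sq_nonneg _) (fun j => ?_) (hx.mul_left (1 / a 1 ^ 2))
  have h1 := ha 1
  have h2 : a 1 ^ 2 ≤ a j ^ 2 := pow_le_pow_left₀ h1.le (ha_mono one_le) 2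
  rw [div_mul_eq_mul_div, one_mul, le_div_iff₀ (by positivity), mul_comm]
  exact mul_le_mul_of_nonneg_right h2 (sq_nonneg _)

theorem sum_le_of_mem_ellipsoid {a : ℕ+ → ℝ} {θ : Signal} (hθ : θ ∈ ellipsoid a)
    (s : Finset ℕ+) : ∑ j ∈ s, a j ^ 2 * θ j ^ 2 ≤ 1 :=
  (hθ.1.sum_le_tsum s fun _ _ => by positivity).trans hθ.2

/-- On the ellipsoid, the coefficients beyond `D` carry at most `1 / a D ^ 2` of the squared
norm. -/
theorem norm_sq_le_of_mem_ellipsoid {a : ℕ+ → ℝ} (ha : ∀ j, 0 < a j) (ha_mono : Monotone a)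
    {θ : Signal} (hθ : θ ∈ ellipsoid a) (D : ℕ+) :
    ‖θ‖ ^ 2 ≤ ∑ j ∈ Finset.Iic D, θ j ^ 2 + 1 / a D ^ 2 := by
  have h1 : HasSum (fun j => if j ∈ Finset.Iic D then θ j ^ 2 else 0)
      (∑ j ∈ Finset.Iic D, θ j ^ 2) := by
    have := hasSum_sum_of_ne_finset_zero (L := .unconditional ℕ+) (s := Finset.Iic D)
      (f := fun j => if j ∈ Finset.Iic D then θ j ^ 2 else 0) fun j hj => if_neg hj
    rwa [Finset.sum_congr rfl fun j hj => if_pos hj] at this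
  have h2 := hθ.1.hasSum.mul_left (1 / a D ^ 2)
  have hD := ha D
  refine (hasSum_le (fun j => ?_) (hasSum_sq θ) (h1.add h2)).trans ?_
  · by_cases hj : j ∈ Finset.Iic D
    · have : 0 ≤ 1 / a D ^ 2 * (a j ^ 2 * θ j ^ 2) := by positivity
      simp only [hj, if_true]
      linarith
    · simp only [hj, if_false, zero_add]
      have hDj : D ≤ j := (not_le.1 fun h => hj (Finset.mem_Iic.2 h)).le
      have h2 : a D ^ 2 ≤ a j ^ 2 := pow_le_pow_left₀ hD.le (ha_mono hDj) 2
      rw [div_mul_eq_mul_div, one_mul, le_div_iff₀ (by positivity), mul_comm]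
      exact mul_le_mul_of_nonneg_right h2 (sq_nonneg _)
  · have : 1 / a D ^ 2 * ∑' j, a j ^ 2 * θ j ^ 2 ≤ 1 / a D ^ 2 * 1 :=
      mul_le_mul_of_nonneg_left hθ.2 (by positivity)
    linarith

theorem summable_mul_sq_mul_sq {b : ℕ+ → ℝ} {B : ℝ} (hb : ∀ j, |b j| ≤ B) (θ η : Signal) :
    Summable fun j => b j ^ 4 * (θ j ^ 2 * η j ^ 2) := by
  refine Summable.of_nonneg_of_le (fun j => by positivity) (fun j => ?_)
    ((hasSum_sq η).summable.mul_left (B ^ 4 * ‖θ‖ ^ 2))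
  have h1 : b j ^ 4 ≤ B ^ 4 := by
    rw [← (show Even 4 by decide).pow_abs (b j)]
    exact pow_le_pow_left₀ (abs_nonneg _) (hb j) 4
  rw [mul_assoc]
  exact mul_le_mul h1 (mul_le_mul_of_nonneg_right (sq_le_norm_sq θ j) (sq_nonneg _))
    (by positivity) (by positivity)

theorem summable_energy {b : ℕ+ → ℝ} {B : ℝ} (hb : ∀ j, |b j| ≤ B) (θ : Signal) :
    Summable fun j => b j ^ 4 * θ j ^ 4 := by
  refine (summable_mul_sq_mul_sq hb θ θ).congr fun j => by ring

theorem tsum_le_of_isExtremal {a b : ℕ+ → ℝ} {ε r : ℝ} (hε : 0 < ε) {θbar θ : Signal}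
    (h : IsExtremal a b ε r θbar) (hθ : θ ∈ alternative a r) :
    ∑' k, b k ^ 4 * θbar k ^ 4 ≤ ∑' k, b k ^ 4 * θ k ^ 4 :=
  le_of_mul_le_mul_left (h.2 θ hθ) (by positivity)

/-- The norm constraint is not closed under pointwise convergence by itself, but on the ellipsoid no
mass escapes to infinity because `a` tends to infinity. A lower semicontinuous energy then attains
its minimum on a compact set. -/
theorem exists_isExtremal {a b : ℕ+ → ℝ} (ha : ∀ j, 0 < a j) (ha_mono : Monotone a)
    (ha_top : Filter.Tendsto a Filter.atTop Filter.atTop) {B : ℝ} (hb : ∀ j, |b j| ≤ B)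
    {ε r : ℝ} (hε : 0 < ε) (hr : 0 ≤ r) (hne : (alternative a r).Nonempty) :
    ∃ θbar, IsExtremal a b ε r θbar := by
  -- The condition `r ≤ ‖x‖` is encoded by closed conditions on finitely many coordinates each, the
  -- tail beyond `D` costing at most `1 / a D ^ 2`.
  let K : Set (ℕ+ → ℝ) := Set.pi Set.univ (fun j => Set.Icc (-(1 / a j)) (1 / a j)) ∩
    ({x | ∀ s : Finset ℕ+, ∑ j ∈ s, a j ^ 2 * x j ^ 2 ≤ 1} ∩
      {x | ∀ D : ℕ+, r ^ 2 ≤ ∑ j ∈ Finset.Iic D, x j ^ 2 + 1 / a D ^ 2})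
  have hK : IsCompact K := by
    refine (isCompact_univ_pi fun j => isCompact_Icc).inter_right (IsClosed.inter ?_ ?_)
    · simp only [Set.ofPred_forall]
      exact isClosed_iInter fun s => isClosed_le (by fun_prop) continuous_const
    · simp only [Set.ofPred_forall]
      exact isClosed_iInter fun D => isClosed_le continuous_const (by fun_prop)
  have hmem : ∀ θ ∈ alternative a r, (fun j => θ j) ∈ K := fun θ hθ => by
    refine ⟨fun j _ => ?_, fun s => sum_le_of_mem_ellipsoid hθ.1 s, fun D => ?_⟩
    · have h1 := sum_le_of_mem_ellipsoid hθ.1 {j}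
      rw [Finset.sum_singleton, ← mul_pow, sq_le_one_iff_abs_le_one, abs_mul,
        abs_of_pos (ha j)] at h1
      rw [Set.mem_Icc, ← abs_le, le_div_iff₀ (ha j), mul_comm]
      exact h1
    · exact (pow_le_pow_left₀ hr hθ.2 2).trans
        (norm_sq_le_of_mem_ellipsoid ha ha_mono hθ.1 D)
  -- With values in `ℝ≥0∞` the energy is a sum of nonnegative continuous terms, so no summability on
  -- `K` is needed.
  have hlsc : LowerSemicontinuous fun x : ℕ+ → ℝ =>
      ∑' k, ENNReal.ofReal (b k ^ 4 * x k ^ 4) :=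
    lowerSemicontinuous_tsum fun k =>
      (ENNReal.continuous_ofReal.comp (by fun_prop)).lowerSemicontinuous
  obtain ⟨θ₀, hθ₀⟩ := hne
  obtain ⟨x, hx, hmin⟩ := (hlsc.lowerSemicontinuousOn K).exists_isMinOn ⟨_, hmem θ₀ hθ₀⟩ hK
  have hsa : Summable fun j => a j ^ 2 * x j ^ 2 :=
    summable_of_sum_le (fun j => by positivity) hx.2.1
  have hs : Summable fun j => x j ^ 2 := summable_of_le_one ha ha_mono hsa
  have hs4 : Summable fun j => b j ^ 4 * x j ^ 4 := summable_energy hb (ofSummable x hs)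
  refine ⟨ofSummable x hs, ⟨⟨hsa, hsa.tsum_le_of_sum_le hx.2.1⟩, ?_⟩, fun θ hθ => ?_⟩
  · refine le_of_sq_le_sq ?_ (norm_nonneg _)
    have hlim : Filter.Tendsto (fun D : ℕ+ => ‖ofSummable x hs‖ ^ 2 + 1 / a D ^ 2) Filter.atTop
        (nhds (‖ofSummable x hs‖ ^ 2 + 0)) := by
      refine Filter.Tendsto.const_add _ ?_
      simp only [one_div]
      exact ((Filter.tendsto_pow_atTop two_ne_zero).comp ha_top).inv_tendsto_atTop
    rw [add_zero] at hlim
    refine ge_of_tendsto' hlim fun D => (hx.2.2 D).trans ?_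
    gcongr
    exact sum_le_hasSum _ (fun j _ => sq_nonneg _) (hasSum_sq (ofSummable x hs))
  · unfold energy
    refine mul_le_mul_of_nonneg_left ?_ (by positivity)
    have h := hmin (hmem θ hθ)
    simp only [Set.mem_ofPred_eq] at h
    rw [← ENNReal.ofReal_tsum_of_nonneg (fun k => by positivity) (summable_energy hb θ),
      ← ENNReal.ofReal_tsum_of_nonneg (fun k => by positivity) hs4] at h
    exact (ENNReal.ofReal_le_ofReal_iff (tsum_nonneg fun k => by positivity)).1 h

/-- Variational inequality at an extremal sequence: the problem is convex in the squared
coefficients. -/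
theorem tsum_le_tsum_mul_of_isExtremal {a b : ℕ+ → ℝ} {B : ℝ} (hb : ∀ j, |b j| ≤ B) {ε r : ℝ}
    (hε : 0 < ε) (hr : 0 ≤ r) {θbar θ : Signal} (h : IsExtremal a b ε r θbar)
    (hθ : θ ∈ alternative a r) :
    ∑' k, b k ^ 4 * θbar k ^ 4 ≤ ∑' k, b k ^ 4 * (θbar k ^ 2 * θ k ^ 2) := by
  have hA := summable_energy hb θbar
  have hB := summable_mul_sq_mul_sq hb θbar θ
  have hG := summable_energy hb θ
  set A := ∑' k, b k ^ 4 * θbar k ^ 4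
  set C := ∑' k, b k ^ 4 * (θbar k ^ 2 * θ k ^ 2)
  set G := ∑' k, b k ^ 4 * θ k ^ 4
  have hQ0 : 0 ≤ A - 2 * C + G := by
    have h1 := (hA.hasSum.sub (hB.hasSum.mul_left 2)).add hG.hasSum
    refine h1.nonneg fun k => ?_
    nlinarith [mul_nonneg (sq_nonneg (b k ^ 2)) (sq_nonneg (θbar k ^ 2 - θ k ^ 2))]
  -- The segment between the squared signals stays in the alternative; minimality along it gives
  -- this inequality for the quadratic polynomial in `l`.
  have key : ∀ l : ℝ, 0 ≤ l → l ≤ 1 → 0 ≤ 2 * l * (C - A) + l ^ 2 * (A - 2 * C + G) := by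
    intro l hl0 hl1
    let x : ℕ+ → ℝ := fun j => √((1 - l) * θbar j ^ 2 + l * θ j ^ 2)
    have hx2 : ∀ j, x j ^ 2 = (1 - l) * θbar j ^ 2 + l * θ j ^ 2 := fun j => by
      have : 0 ≤ 1 - l := by linarith
      exact Real.sq_sqrt (by positivity)
    have hs2 : HasSum (fun j => x j ^ 2) ((1 - l) * ‖θbar‖ ^ 2 + l * ‖θ‖ ^ 2) := by
      simp only [hx2]
      exact ((hasSum_sq θbar).mul_left _).add ((hasSum_sq θ).mul_left _)
    have hsa : HasSum (fun j => a j ^ 2 * x j ^ 2)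
        ((1 - l) * ∑' j, a j ^ 2 * θbar j ^ 2 + l * ∑' j, a j ^ 2 * θ j ^ 2) := by
      have := (h.1.1.1.hasSum.mul_left (1 - l)).add (hθ.1.1.hasSum.mul_left l)
      refine (hasSum_congr_term fun j => ?_).1 this
      rw [hx2]; ring
    have hs4 : HasSum (fun j => b j ^ 4 * x j ^ 4) ((1 - l) ^ 2 * A + 2 * (l * (1 - l)) * C
        + l ^ 2 * G) := by
      have := ((hA.hasSum.mul_left ((1 - l) ^ 2)).add
        (hB.hasSum.mul_left (2 * (l * (1 - l))))).add (hG.hasSum.mul_left (l ^ 2))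
      refine (hasSum_congr_term fun j => ?_).1 this
      rw [show x j ^ 4 = (x j ^ 2) ^ 2 by ring, hx2]; ring
    have hmem : ofSummable x hs2.summable ∈ alternative a r := by
      refine ⟨⟨hsa.summable, ?_⟩, le_of_sq_le_sq ?_ (norm_nonneg _)⟩
      · refine (hsa.tsum_eq).trans_le ?_
        nlinarith [h.1.1.2, hθ.1.2]
      · rw [(hasSum_sq (ofSummable x hs2.summable)).unique hs2]
        nlinarith [pow_le_pow_left₀ hr h.1.2 2, pow_le_pow_left₀ hr hθ.2 2]
    have hle := tsum_le_of_isExtremal hε h hmem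
    simp only [ofSummable_apply] at hle
    rw [hs4.tsum_eq] at hle
    linarith
  by_contra! hlt
  have hd : 0 < A - C := by linarith
  have hden : 0 < A - 2 * C + G + (A - C) := by linarith
  -- Adding `A - C` to the denominator keeps `l` in `(0, 1]` even if the quadratic coefficient
  -- vanishes, and makes the linear term win strictly.
  have h1 := key ((A - C) / (A - 2 * C + G + (A - C))) (by positivity)
    ((div_le_one hden).2 (by linarith))
  set l := (A - C) / (A - 2 * C + G + (A - C)) with hl
  have hl0 : 0 < l := by positivity
  have hl2 : l * (A - 2 * C + G + (A - C)) = A - C := by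
    rw [hl, div_mul_cancel₀ _ hden.ne']
  nlinarith [mul_pos hl0 hd]


/-! ### Rates -/

theorem exists_pnat_ceil {x : ℝ} (hx : 1 ≤ x) : ∃ D : ℕ+, x ≤ D ∧ (D : ℝ) ≤ 2 * x := by
  have h : 0 < ⌈x⌉₊ := Nat.ceil_pos.2 (by linarith)
  refine ⟨⟨⌈x⌉₊, h⟩, Nat.le_ceil x, ?_⟩
  have := Nat.ceil_lt_add_one (by linarith : 0 ≤ x)
  simp only [PNat.mk_coe]
  linarith

/-- At `R = X` the two powers balance. The first branch decreases and the second increases in `R`,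
so one of them is at least its value at `X` for every other `R`. The condition `2 ≤ X` makes `X` an
admissible competitor. -/
theorem tuningRadius_sq_bounds {s t C₀ c' ε X : ℝ} (hs : 0 < s) (ht : 0 < t) (hC₀ : 0 < C₀)
    (hc' : 0 < c') (hX : 2 ≤ X) (hε : ε ^ 2 = X ^ (-(2 * s + 2 * t + 1 / 2))) :
    min C₀ c' * X ^ (-2 * s) ≤ tuningRadius s t C₀ c' ε ^ 2 ∧
      tuningRadius s t C₀ c' ε ^ 2 ≤ max C₀ c' * X ^ (-2 * s) := by
  have hX0 : 0 < X := by linarith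
  have hbal : ε ^ 2 * X ^ (2 * t + 1 / 2) = X ^ (-2 * s) := by
    rw [hε, ← Real.rpow_add hX0]; congr 1; ring
  set S := (fun R : ℝ => max (C₀ * R ^ (-2 * s)) (c' * ε ^ 2 * R ^ (2 * t + 1 / 2))) '' Set.Ici 2
    with hS
  have hpos : ∀ y ∈ S, 0 ≤ y := by
    rintro y ⟨R, hR, rfl⟩
    have : 0 < R := lt_of_lt_of_le two_pos hR
    exact le_max_of_le_left (by positivity)
  have hsq : tuningRadius s t C₀ c' ε ^ 2 = sInf S := Real.sq_sqrt (Real.sInf_nonneg hpos)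
  have hXs : 0 < X ^ (-2 * s) := Real.rpow_pos_of_pos hX0 _
  rw [hsq]
  constructor
  · refine le_csInf ⟨_, X, hX, rfl⟩ ?_
    rintro y ⟨R, hR, rfl⟩
    have hR0 : 0 < R := lt_of_lt_of_le two_pos hR
    rcases le_total R X with h | h
    · refine le_max_of_le_left (mul_le_mul (min_le_left _ _) ?_ hXs.le hC₀.le)
      exact Real.rpow_le_rpow_of_nonpos hR0 h (by linarith)
    · refine le_max_of_le_right ?_
      rw [mul_assoc]
      refine mul_le_mul (min_le_right _ _) ?_ hXs.le hc'.le
      rw [← hbal]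
      gcongr
  · refine (csInf_le ⟨0, hpos⟩ ⟨X, hX, rfl⟩).trans (max_le ?_ ?_)
    · exact mul_le_mul_of_nonneg_right (le_max_left _ _) hXs.le
    · rw [mul_assoc, hbal]
      exact mul_le_mul_of_nonneg_right (le_max_right _ _) hXs.le

/-- At the tuning radius the energy of the alternative is bounded away from zero. -/
theorem exists_energy_lower_bound {a b : ℕ+ → ℝ} {s t κa κb k : ℝ} (hs : 0 < s) (ht : 0 < t)
    (ha_pos : ∀ j, 0 < a j) (ha_mono : Monotone a) (hκa : 0 < κa) (hκb : 0 < κb) (hk : 0 < k)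
    (ha : ∀ j : ℕ+, κa * (j : ℝ) ^ s ≤ a j) (hb : ∀ j : ℕ+, κb * (j : ℝ) ^ (-t) ≤ b j)
    {B : ℝ} (hB : ∀ j, |b j| ≤ B) :
    ∃ c : ℝ, 0 < c ∧ ∀ X r : ℝ, 1 ≤ X → 0 ≤ r → k * X ^ (-2 * s) ≤ r ^ 2 →
      ∀ θ ∈ alternative a r, c * X ^ (-(4 * s + 4 * t + 1)) ≤ ∑' j, b j ^ 4 * θ j ^ 4 := by
  -- Chosen so that cutting at an integer `D ≥ K X` leaves at most half of `r ^ 2` in the tail.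
  set K : ℝ := max 1 ((2 / (κa ^ 2 * k)) ^ (1 / (2 * s))) with hK
  have hK1 : 1 ≤ K := le_max_left _ _
  have hK0 : 0 < K := by linarith
  have hKs : 2 / (κa ^ 2 * k) ≤ K ^ (2 * s) := by
    have h0 : 0 ≤ 2 / (κa ^ 2 * k) := by positivity
    calc 2 / (κa ^ 2 * k) = ((2 / (κa ^ 2 * k)) ^ (1 / (2 * s))) ^ (2 * s) := by
          rw [← Real.rpow_mul h0, one_div_mul_cancel (by positivity), Real.rpow_one]
      _ ≤ K ^ (2 * s) := Real.rpow_le_rpow (by positivity) (le_max_right _ _) (by positivity)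
  refine ⟨κb ^ 4 * (k ^ 2 / 4) * (2 * K) ^ (-(4 * t + 1)), by positivity,
    fun X r hX hr hkr θ hθ => ?_⟩
  have hX0 : 0 < X := by linarith
  obtain ⟨D, hD1, hD2⟩ := exists_pnat_ceil (x := K * X) (by nlinarith)
  have hD0 : (0 : ℝ) < D := Nat.cast_pos.2 D.pos
  have htail : 1 / a D ^ 2 ≤ r ^ 2 / 2 := by
    have h1 : κa ^ 2 * (K * X) ^ (2 * s) ≤ a D ^ 2 := by
      calc κa ^ 2 * (K * X) ^ (2 * s) ≤ κa ^ 2 * (D : ℝ) ^ (2 * s) := by gcongr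
        _ = (κa * (D : ℝ) ^ s) ^ 2 := by
          rw [mul_pow, ← Real.rpow_natCast ((D : ℝ) ^ s), ← Real.rpow_mul hD0.le]
          congr 2; push_cast; ring
        _ ≤ a D ^ 2 := pow_le_pow_left₀ (by positivity) (ha D) 2
    have h2 : κa ^ 2 * (K * X) ^ (2 * s) * (k * X ^ (-2 * s)) ≥ 2 := by
      have e : X ^ (2 * s) * X ^ (-2 * s) = 1 := by
        rw [← Real.rpow_add hX0, ← Real.rpow_zero X]; congr 1; ring
      rw [Real.mul_rpow hK0.le hX0.le]
      calc κa ^ 2 * (K ^ (2 * s) * X ^ (2 * s)) * (k * X ^ (-2 * s))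
          = κa ^ 2 * k * K ^ (2 * s) * (X ^ (2 * s) * X ^ (-2 * s)) := by ring
        _ = κa ^ 2 * k * K ^ (2 * s) := by rw [e, mul_one]
        _ ≥ κa ^ 2 * k * (2 / (κa ^ 2 * k)) := mul_le_mul_of_nonneg_left hKs (by positivity)
        _ = 2 := by field_simp
    have hkX : 0 < k * X ^ (-2 * s) := by positivity
    rw [div_le_iff₀ (pow_pos (ha_pos D) 2)]
    nlinarith [mul_le_mul h1 hkr hkX.le (sq_nonneg (a D))]
  have hhead : r ^ 2 / 2 ≤ ∑ j ∈ Finset.Iic D, θ j ^ 2 := by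
    have h1 := norm_sq_le_of_mem_ellipsoid ha_pos ha_mono hθ.1 D
    have h2 := pow_le_pow_left₀ hr hθ.2 2
    linarith
  have hcard : ((Finset.Iic D).card : ℝ) = D := by
    have : Finset.Iic D = Finset.Icc 1 D := by ext j; simp
    rw [this, PNat.card_Icc]; simp
  have hb4 : ∀ j ∈ Finset.Iic D, κb ^ 4 * (D : ℝ) ^ (-(4 * t)) * (θ j ^ 2) ^ 2 ≤
      b j ^ 4 * θ j ^ 4 := fun j hj => by
    have hjD : (j : ℝ) ≤ D := by exact_mod_cast Finset.mem_Iic.1 hj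
    have hj0 : (0 : ℝ) < j := Nat.cast_pos.2 j.pos
    have h1 : κb ^ 4 * (D : ℝ) ^ (-(4 * t)) ≤ b j ^ 4 := by
      calc κb ^ 4 * (D : ℝ) ^ (-(4 * t)) ≤ κb ^ 4 * (j : ℝ) ^ (-(4 * t)) := by
            gcongr κb ^ 4 * ?_
            exact Real.rpow_le_rpow_of_nonpos hj0 hjD (by linarith)
        _ = (κb * (j : ℝ) ^ (-t)) ^ 4 := by
          rw [mul_pow, ← Real.rpow_natCast ((j : ℝ) ^ (-t)), ← Real.rpow_mul hj0.le]
          congr 2; push_cast; ring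
        _ ≤ b j ^ 4 := pow_le_pow_left₀ (by positivity) (hb j) 4
    rw [← pow_mul]
    exact mul_le_mul_of_nonneg_right h1 (Even.pow_nonneg (by decide) _)
  have hS : κb ^ 4 * (D : ℝ) ^ (-(4 * t)) * ∑ j ∈ Finset.Iic D, (θ j ^ 2) ^ 2 ≤
      ∑' j, b j ^ 4 * θ j ^ 4 := by
    rw [Finset.mul_sum]
    exact (Finset.sum_le_sum hb4).trans
      ((summable_energy hB θ).sum_le_tsum _ fun _ _ => by positivity)
  -- Cauchy–Schwarz on `D` coordinates: the fourth powers are smallest when the squared norm is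
  -- spread evenly.
  have hcs := sq_sum_le_card_mul_sum_sq (s := Finset.Iic D) (f := fun j => θ j ^ 2)
  rw [hcard] at hcs
  have hkk : (k * X ^ (-2 * s) / 2) ^ 2 ≤ (∑ j ∈ Finset.Iic D, θ j ^ 2) ^ 2 :=
    pow_le_pow_left₀ (by positivity) (by linarith) 2
  have hDpow : (2 * K) ^ (-(4 * t + 1)) * X ^ (-(4 * t + 1)) ≤ (D : ℝ) ^ (-(4 * t + 1)) := by
    rw [← Real.mul_rpow (by positivity) hX0.le]
    exact Real.rpow_le_rpow_of_nonpos hD0 (by linarith) (by linarith)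
  have hDsplit : (D : ℝ) ^ (-(4 * t + 1)) * D = (D : ℝ) ^ (-(4 * t)) := by
    nth_rewrite 2 [← Real.rpow_one (D : ℝ)]
    rw [← Real.rpow_add hD0]; congr 1; ring
  have hXsplit : X ^ (-(4 * s + 4 * t + 1)) = X ^ (-(4 * t + 1)) * (X ^ (-2 * s)) ^ 2 := by
    rw [← Real.rpow_natCast (X ^ (-2 * s)), ← Real.rpow_mul hX0.le, ← Real.rpow_add hX0]
    congr 1; push_cast; ring
  calc κb ^ 4 * (k ^ 2 / 4) * (2 * K) ^ (-(4 * t + 1)) * X ^ (-(4 * s + 4 * t + 1))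
      = κb ^ 4 * ((2 * K) ^ (-(4 * t + 1)) * X ^ (-(4 * t + 1))) * (k * X ^ (-2 * s) / 2) ^ 2 := by
        rw [hXsplit]; ring
    _ ≤ κb ^ 4 * (D : ℝ) ^ (-(4 * t + 1)) * (D * ∑ j ∈ Finset.Iic D, (θ j ^ 2) ^ 2) := by
        refine mul_le_mul (by gcongr) (hkk.trans hcs) (sq_nonneg _) (by positivity)
    _ = κb ^ 4 * (D : ℝ) ^ (-(4 * t)) * ∑ j ∈ Finset.Iic D, (θ j ^ 2) ^ 2 := by
        rw [← hDsplit]; ring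
    _ ≤ _ := hS

/-! ### Lower bound for the minimax radius -/

/-- Squares forget signs, so all sign patterns share the same norm and the same ellipsoid
constraint. -/
theorem hasSum_signedShift (F t : Finset ℕ+) (f : ℕ+ → ℝ) (τ : ℝ) :
    HasSum (fun j => f j * signedShift F t (fun _ => τ) j ^ 2) (∑ j ∈ F, f j * τ ^ 2) := by
  have h := hasSum_sum_of_ne_finset_zero (L := .unconditional ℕ+) (s := F)
    (f := fun j => f j * signedShift F t (fun _ => τ) j ^ 2) fun j hj => by simp [signedShift, hj]
  rwa [Finset.sum_congr rfl fun j hj => show f j * signedShift F t (fun _ => τ) j ^ 2 =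
    f j * τ ^ 2 by simp only [signedShift, hj, if_true]; split_ifs <;> ring] at h

/-- If the signals with coefficients `± τ` on `F` belong to the alternative of radius `r` and are
too weak to be detected, no test of level `α` has a separation radius smaller than `r`. -/
theorem le_minimaxRadius {a b : ℕ+ → ℝ} {ε α β r τ : ℝ} (ha : ∀ j, 0 < a j)
    (ha_mono : Monotone a) (hε : 0 < ε) (hα : 0 ≤ α) (hβ : 0 ≤ β) (hαβ : α + β < 1)
    (F : Finset ℕ+) (hr : r ^ 2 ≤ F.card * τ ^ 2) (hF : ∑ j ∈ F, a j ^ 2 * τ ^ 2 ≤ 1)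
    (hχ : Real.exp ((∑ j ∈ F, (b j * τ / ε) ^ 4) / 2) - 1 < (1 - α - β) ^ 2) :
    r ≤ minimaxRadius a b ε α β := by
  -- The two infima need nonempty sets, since `sInf ∅ = 0` in `ℝ`; the test that never rejects
  -- serves here.
  have hlevel : (levelTests b ε α).Nonempty :=
    ⟨fun _ => 0, measurable_const, by simp [firstKindError]⟩
  refine le_csInf (hlevel.image _) ?_
  rintro _ ⟨Ψ, ⟨hΨm, hΨα⟩, rfl⟩
  have hne : {r : ℝ | 0 < r ∧ secondKindError b ε (alternative a r) Ψ ≤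
      ENNReal.ofReal β}.Nonempty := by
    have ha1 := ha 1
    -- On the ellipsoid the norm is at most `1 / a 1`, so the alternative at this radius is empty.
    refine ⟨1 / a 1 + 1, by positivity, ?_⟩
    have hempty : alternative a (1 / a 1 + 1) = ∅ := by
      refine Set.eq_empty_of_forall_notMem fun θ hθ => ?_
      have h1 : ‖θ‖ ^ 2 ≤ (1 / a 1) ^ 2 := by
        refine hasSum_le (fun j => ?_) (hasSum_sq θ) (hθ.1.1.hasSum.mul_left ((1 / a 1) ^ 2))
          |>.trans ?_
        · have h2 : a 1 ^ 2 ≤ a j ^ 2 := pow_le_pow_left₀ ha1.le (ha_mono one_le) 2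
          rw [div_pow, one_pow, div_mul_eq_mul_div, one_mul, le_div_iff₀ (by positivity), mul_comm]
          exact mul_le_mul_of_nonneg_right h2 (sq_nonneg _)
        · have := mul_le_mul_of_nonneg_left hθ.1.2 (sq_nonneg (1 / a 1))
          linarith
      have h2 := le_of_sq_le_sq h1 (by positivity)
      linarith [hθ.2]
    rw [hempty, secondKindError]
    simp
  refine le_csInf hne ?_
  rintro r' ⟨hr'0, hr'⟩
  by_contra! hlt
  have hS : MeasurableSet {y | Ψ y = 0} := hΨm (measurableSet_singleton 0)
  set A : Set (ℕ+ → ℝ) := {ξ | Ψ (fun j => ε * ξ j) = 0} with hAdef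
  have hscale : Measurable fun (ξ : ℕ+ → ℝ) (j : ℕ+) => ε * ξ j := by fun_prop
  have hA : MeasurableSet A := hscale hS
  have hlt' : noise.real A < β + (1 - α - β) := by
    refine noise_real_lt_of_signedShift F (fun j => b j * τ / ε) hA hβ (by linarith)
      (fun t _ => ?_) hχ
    have h1 := hasSum_signedShift F t (fun _ => 1) τ
    simp only [one_mul, Finset.sum_const, nsmul_eq_mul] at h1
    have h2 := hasSum_signedShift F t (fun j => a j ^ 2) τ
    set θ : Signal := ofSummable (signedShift F t fun _ => τ) h1.summable with hθ
    have hmem : θ ∈ alternative a r' := by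
      refine ⟨⟨h2.summable, h2.tsum_eq.trans_le hF⟩, hlt.le.trans ?_⟩
      refine le_of_sq_le_sq ?_ (norm_nonneg _)
      rw [(hasSum_sq θ).unique h1]
      exact hr
    refine le_trans (le_of_eq ?_) ((le_iSup₂ (f := fun θ (_ : θ ∈ alternative a r') =>
      law b ε θ {y | Ψ y = 0}) θ hmem).trans hr')
    rw [law, Measure.map_apply (measurable_observation b ε θ) hS,
      Measure.map_apply (by fun_prop) hA]
    congr 1
    ext ξ
    simp only [hAdef, Set.mem_preimage, Set.mem_ofPred_eq]
    have : (fun j => ε * (signedShift F t (fun j => b j * τ / ε) j + ξ j)) =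
        fun j => b j * θ j + ε * ξ j := by
      funext j
      rw [hθ, ofSummable_apply, mul_add]
      congr 1
      unfold signedShift
      split_ifs <;> field_simp
      simp
    rw [this]
  have hge : 1 - α ≤ noise.real A := by
    have hS1 : MeasurableSet {y | Ψ y = 1} := hΨm (measurableSet_singleton 1)
    have h0 : law b ε 0 {y | Ψ y = 1} = noise Aᶜ := by
      rw [law, Measure.map_apply (measurable_observation b ε 0) hS1]
      congr 1
      ext ξ
      simp only [hAdef, Set.mem_preimage, Set.mem_ofPred_eq, Set.mem_compl_iff]
      have : (fun j => b j * (0 : Signal) j + ε * ξ j) = fun j => ε * ξ j := by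
        funext j; simp
      rw [this]
      omega
    rw [firstKindError, h0] at hΨα
    have h1 : noise.real Aᶜ ≤ α := ENNReal.toReal_le_of_le_ofReal hα hΨα
    rw [probReal_compl_eq_one_sub hA] at h1
    linarith
  linarith

/-- The block `[D, 2D)` with `X ≤ D ≤ 2X` keeps `a j` of order at most `X ^ s` and `b j` of order at
most `X ^ (-t)`; an amplitude of order `X ^ (-s) / √D` then meets the ellipsoid constraint and stays
undetectable. -/
theorem exists_minimaxRadius_lower_bound {a b : ℕ+ → ℝ} {s t κa κb α β : ℝ} (hs : 0 < s)
    (ht : 0 < t) (ha_pos : ∀ j, 0 < a j) (ha_mono : Monotone a) (hb_pos : ∀ j, 0 < b j)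
    (hκa : 0 < κa) (hκb : 0 < κb)
    (ha : ∀ j : ℕ+, a j ≤ κa * (j : ℝ) ^ s) (hb : ∀ j : ℕ+, b j ≤ κb * (j : ℝ) ^ (-t))
    (hα : 0 ≤ α) (hβ : 0 ≤ β) (hαβ : α + β < 1) :
    ∃ c : ℝ, 0 < c ∧ ∀ X ε : ℝ, 1 ≤ X → 0 < ε → ε ^ 4 = X ^ (-(4 * s + 4 * t + 1)) →
      c * X ^ (-s) ≤ minimaxRadius a b ε α β := by
  have hlog : 0 < Real.log (1 + (1 - α - β) ^ 2) := by
    have : 0 < 1 - α - β := by linarith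
    exact Real.log_pos (by nlinarith)
  -- The first entry keeps the block signal in the ellipsoid; the second keeps the sum of fourth
  -- powers below the logarithm, and the factor `1/2` in the exponent makes the final inequality
  -- strict.
  set η : ℝ := min (1 / (κa ^ 2 * 4 ^ (2 * s))) (√(Real.log (1 + (1 - α - β) ^ 2) / κb ^ 4))
    with hη
  have hη0 : 0 < η := lt_min (by positivity) (by positivity)
  refine ⟨√η, by positivity, fun X ε hX hε hεX => ?_⟩
  have hX0 : 0 < X := by linarith
  obtain ⟨D, hD1, hD2⟩ := exists_pnat_ceil hX
  have hD0 : (0 : ℝ) < D := Nat.cast_pos.2 D.pos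
  set Y := X ^ (-s) with hY
  have hY0 : 0 < Y := Real.rpow_pos_of_pos hX0 _
  have hcard : ((Finset.Ico D (D + D)).card : ℝ) = D := by rw [PNat.card_Ico]; simp
  have hτ : (√η * Y / √D) ^ 2 = η * Y ^ 2 / D := by
    rw [div_pow, mul_pow, Real.sq_sqrt hη0.le, Real.sq_sqrt hD0.le]
  refine le_minimaxRadius (τ := √η * Y / √D) ha_pos ha_mono hε hα hβ hαβ (Finset.Ico D (D + D))
    ?_ ?_ ?_
  · rw [hcard, hτ, mul_pow, Real.sq_sqrt hη0.le]
    exact le_of_eq (by field_simp)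
  · have hterm : ∀ j ∈ Finset.Ico D (D + D), a j ^ 2 * (√η * Y / √D) ^ 2 ≤ 1 / D := fun j hj => by
      have hj0 : (0 : ℝ) < j := Nat.cast_pos.2 j.pos
      have hjD : (j : ℝ) ≤ 4 * X := by
        have : j < D + D := (Finset.mem_Ico.1 hj).2
        have : (j : ℝ) < D + D := by exact_mod_cast this
        linarith
      have h1 : a j ^ 2 ≤ κa ^ 2 * (4 ^ (2 * s) * X ^ (2 * s)) := by
        calc a j ^ 2 ≤ (κa * (j : ℝ) ^ s) ^ 2 := pow_le_pow_left₀ (ha_pos j).le (ha j) 2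
          _ = κa ^ 2 * (j : ℝ) ^ (2 * s) := by
            rw [mul_pow, ← Real.rpow_natCast ((j : ℝ) ^ s), ← Real.rpow_mul hj0.le]
            congr 2; push_cast; ring
          _ ≤ κa ^ 2 * (4 * X) ^ (2 * s) := by gcongr
          _ = _ := by rw [Real.mul_rpow (by norm_num) hX0.le]
      have e : X ^ (2 * s) * Y ^ 2 = 1 := by
        rw [hY, ← Real.rpow_natCast, ← Real.rpow_mul hX0.le, ← Real.rpow_add hX0,
          ← Real.rpow_zero X]
        congr 1; push_cast; ring
      have h2 : κa ^ 2 * 4 ^ (2 * s) * η ≤ 1 := by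
        have := mul_le_mul_of_nonneg_left (min_le_left _ _ : η ≤ 1 / (κa ^ 2 * 4 ^ (2 * s)))
          (by positivity : 0 ≤ κa ^ 2 * 4 ^ (2 * s))
        rwa [mul_one_div_cancel (by positivity)] at this
      rw [hτ, ← mul_div_assoc, div_le_div_iff_of_pos_right hD0]
      calc a j ^ 2 * (η * Y ^ 2)
          ≤ κa ^ 2 * (4 ^ (2 * s) * X ^ (2 * s)) * (η * Y ^ 2) := by gcongr
        _ = κa ^ 2 * 4 ^ (2 * s) * η * (X ^ (2 * s) * Y ^ 2) := by ring
        _ ≤ 1 := by rw [e, mul_one]; exact h2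
    refine (Finset.sum_le_sum hterm).trans_eq ?_
    rw [Finset.sum_const, nsmul_eq_mul, hcard]
    field_simp
  · have hterm : ∀ j ∈ Finset.Ico D (D + D), (b j * (√η * Y / √D) / ε) ^ 4 ≤
        κb ^ 4 * η ^ 2 / D := fun j hj => by
      have hj0 : (0 : ℝ) < j := Nat.cast_pos.2 j.pos
      have hDj : (D : ℝ) ≤ j := by exact_mod_cast (Finset.mem_Ico.1 hj).1
      have h1 : b j ^ 4 ≤ κb ^ 4 * (D : ℝ) ^ (-(4 * t)) := by
        calc b j ^ 4 ≤ (κb * (j : ℝ) ^ (-t)) ^ 4 := pow_le_pow_left₀ (hb_pos j).le (hb j) 4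
          _ = κb ^ 4 * (j : ℝ) ^ (-(4 * t)) := by
            rw [mul_pow, ← Real.rpow_natCast ((j : ℝ) ^ (-t)), ← Real.rpow_mul hj0.le]
            congr 2; push_cast; ring
          _ ≤ κb ^ 4 * (D : ℝ) ^ (-(4 * t)) := by
            gcongr κb ^ 4 * ?_
            exact Real.rpow_le_rpow_of_nonpos hD0 hDj (by linarith)
      have hDsplit : (D : ℝ) ^ (-(4 * t + 1)) * D = (D : ℝ) ^ (-(4 * t)) := by
        nth_rewrite 2 [← Real.rpow_one (D : ℝ)]
        rw [← Real.rpow_add hD0]; congr 1; ring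
      have hDX : (D : ℝ) ^ (-(4 * t + 1)) ≤ X ^ (-(4 * t + 1)) :=
        Real.rpow_le_rpow_of_nonpos hX0 hD1 (by linarith)
      have e : ε ^ 4 = X ^ (-(4 * t + 1)) * Y ^ 4 := by
        rw [hεX, hY, ← Real.rpow_natCast, ← Real.rpow_mul hX0.le, ← Real.rpow_add hX0]
        congr 1; push_cast; ring
      have e2 : (b j * (√η * Y / √D) / ε) ^ 4 = b j ^ 4 * ((√η * Y / √D) ^ 2) ^ 2 / ε ^ 4 := by
        ring
      rw [e2, hτ, div_le_iff₀ (by positivity), e]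
      calc b j ^ 4 * (η * Y ^ 2 / D) ^ 2
          ≤ κb ^ 4 * (D : ℝ) ^ (-(4 * t)) * (η * Y ^ 2 / D) ^ 2 := by gcongr
        _ = κb ^ 4 * η ^ 2 / D * ((D : ℝ) ^ (-(4 * t + 1)) * Y ^ 4) := by
          rw [← hDsplit]; field_simp
        _ ≤ _ := by gcongr
    have hsum := Finset.sum_le_sum hterm
    rw [Finset.sum_const, nsmul_eq_mul, hcard, mul_div_cancel₀ _ hD0.ne'] at hsum
    have hη2 : κb ^ 4 * η ^ 2 ≤ Real.log (1 + (1 - α - β) ^ 2) := by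
      have h1 : η ^ 2 ≤ Real.log (1 + (1 - α - β) ^ 2) / κb ^ 4 := by
        rw [← Real.sq_sqrt (by positivity :
          0 ≤ Real.log (1 + (1 - α - β) ^ 2) / κb ^ 4)]
        exact pow_le_pow_left₀ hη0.le (min_le_right _ _) 2
      rwa [le_div_iff₀ (by positivity), mul_comm] at h1
    have h1 : (∑ j ∈ Finset.Ico D (D + D), (b j * (√η * Y / √D) / ε) ^ 4) / 2 <
        Real.log (1 + (1 - α - β) ^ 2) := by linarith
    have h2 := Real.exp_lt_exp.2 h1
    rw [Real.exp_log (by positivity)] at h2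
    linarith


/-! ### The Ingster test -/

/-- For `θ` of norm at least `C r`, the signal `θ / C` lies in the alternative of radius `r`. The
variational inequality there, scaled back by `C ^ 2`, bounds the mean of the statistic from below
uniformly in `θ`. -/
theorem separationRadius_ingsterTest_le {a b : ℕ+ → ℝ} {B : ℝ} (hb : ∀ j, |b j| ≤ B)
    {ε α β r C : ℝ} (hε : 0 < ε) (hβ : 0 < β) (hr : 0 < r) (hC : 1 ≤ C) {θbar : Signal}
    (h : IsExtremal a b ε r θbar) (hpos : 0 < ∑' k, b k ^ 4 * θbar k ^ 4)
    (hM : 2 * (|gaussianQuantile (1 - α) + 1| + 1) + (8 * gaussianFourthMoment + 32) / β <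
      C ^ 2 * (√((∑' k, b k ^ 4 * θbar k ^ 4) / 2) / ε ^ 2)) :
    separationRadius a b ε β (ingsterTest b ε α θbar) ≤ C * r := by
  have hC0 : 0 < C := by linarith
  have hA := summable_energy hb θbar
  set A := ∑' k, b k ^ 4 * θbar k ^ 4 with hAdef
  set w := ingsterFilter b θbar with hw
  have hden : 0 < √(2 * A) := Real.sqrt_pos.2 (by positivity)
  have hwj : ∀ j, w j = b j ^ 2 * θbar j ^ 2 / √(2 * A) := fun j => rfl
  have hw0 : ∀ j, 0 ≤ w j := fun j => by rw [hwj]; positivity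
  have hws : Summable w := by
    have : Summable fun j => b j ^ 2 * θbar j ^ 2 := by
      refine Summable.of_nonneg_of_le (fun j => by positivity) (fun j => ?_)
        ((hasSum_sq θbar).summable.mul_left (B ^ 2))
      refine mul_le_mul_of_nonneg_right ?_ (sq_nonneg _)
      rw [← sq_abs]
      exact pow_le_pow_left₀ (abs_nonneg _) (hb j) 2
    exact this.div_const _
  have hw2 : ∀ s : Finset ℕ+, ∑ j ∈ s, w j ^ 2 ≤ 1 := fun s => by
    have e : ∀ j, w j ^ 2 = b j ^ 4 * θbar j ^ 4 / (2 * A) := fun j => by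
      rw [hwj, div_pow, Real.sq_sqrt (by positivity)]; ring
    rw [Finset.sum_congr rfl fun j _ => e j, ← Finset.sum_div, div_le_one (by positivity)]
    have : ∑ j ∈ s, b j ^ 4 * θbar j ^ 4 ≤ A := hA.sum_le_tsum s fun _ _ => by positivity
    linarith
  refine csInf_le ⟨0, fun x hx => hx.1.le⟩ ⟨by positivity, iSup₂_le fun θ hθ => ?_⟩
  have hs := summable_mul_sq_mul_sq hb θbar θ
  have hmean : HasSum (fun j => w j * (b j * θ j / ε) ^ 2)
      ((∑' k, b k ^ 4 * (θbar k ^ 2 * θ k ^ 2)) / (√(2 * A) * ε ^ 2)) := by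
    refine (hasSum_congr_term fun j => ?_).1 (hs.hasSum.div_const (√(2 * A) * ε ^ 2))
    rw [hwj]
    field_simp
  have hscaled : HasSum (fun j => (θ j / C) ^ 2) (‖θ‖ ^ 2 / C ^ 2) := by
    simp only [div_pow]
    exact (hasSum_sq θ).div_const _
  have hvar : C ^ 2 * A ≤ ∑' k, b k ^ 4 * (θbar k ^ 2 * θ k ^ 2) := by
    have hsa : HasSum (fun j => a j ^ 2 * (θ j / C) ^ 2)
        ((∑' j, a j ^ 2 * θ j ^ 2) / C ^ 2) := by
      simp only [div_pow, ← mul_div_assoc]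
      exact hθ.1.1.hasSum.div_const _
    have hmem : ofSummable (fun j => θ j / C) hscaled.summable ∈ alternative a r := by
      refine ⟨⟨hsa.summable, hsa.tsum_eq.trans_le ?_⟩, le_of_sq_le_sq ?_ (norm_nonneg _)⟩
      · rw [div_le_one (by positivity)]
        exact hθ.1.2.trans (one_le_pow₀ hC)
      · rw [(hasSum_sq (ofSummable (fun j => θ j / C) hscaled.summable)).unique hscaled,
          le_div_iff₀ (by positivity), ← mul_pow, mul_comm]
        exact pow_le_pow_left₀ (by positivity) hθ.2 2
    have hle := tsum_le_tsum_mul_of_isExtremal hb hε hr.le h hmem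
    have e : HasSum (fun k => b k ^ 4 * (θbar k ^ 2 *
        (ofSummable (fun j => θ j / C) hscaled.summable) k ^ 2))
        ((∑' k, b k ^ 4 * (θbar k ^ 2 * θ k ^ 2)) / C ^ 2) := by
      refine (hasSum_congr_term fun j => ?_).1 (hs.hasSum.div_const (C ^ 2))
      rw [ofSummable_apply]
      field_simp
    rw [e.tsum_eq, le_div_iff₀ (by positivity), mul_comm] at hle
    exact hle
  have hset : {y | ingsterTest b ε α θbar y = 0} =
      {y | ∑' j, w j * ((y j / ε) ^ 2 - 1) ≤ gaussianQuantile (1 - α)} := by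
    ext y
    rw [Set.mem_ofPred_eq, Set.mem_ofPred_eq, ← not_lt]
    unfold ingsterTest ingsterStatistic
    split_ifs with hc
    · simpa using hc
    · simpa using hc
  rw [hset]
  refine law_quadratic_tsum_le b hε θ w hw0 hws hw2 hmean.summable hβ (hM.trans_le ?_)
  rw [hmean.tsum_eq]
  have hsq : √(A / 2) * √(2 * A) = A := by
    rw [← Real.sqrt_mul (by positivity), show A / 2 * (2 * A) = A ^ 2 by ring,
      Real.sqrt_sq hpos.le]
  have e : C ^ 2 * (√(A / 2) / ε ^ 2) = C ^ 2 * A / (√(2 * A) * ε ^ 2) := by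
    rw [← mul_div_assoc, div_eq_div_iff (by positivity) (by positivity)]
    linear_combination C ^ 2 * ε ^ 2 * hsq
  rw [e]
  gcongr

theorem alternative_nonempty {a : ℕ+ → ℝ} {r : ℝ} (har : a 1 ^ 2 * r ^ 2 ≤ 1) :
    (alternative a r).Nonempty := by
  have h1 := hasSum_signedShift {1} {1} (fun _ => 1) r
  have h2 := hasSum_signedShift {1} {1} (fun j => a j ^ 2) r
  simp only [one_mul, Finset.sum_singleton] at h1 h2
  refine ⟨ofSummable _ h1.summable, ⟨h2.summable, h2.tsum_eq.trans_le har⟩,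
    le_of_sq_le_sq ?_ (norm_nonneg _)⟩
  rw [(hasSum_sq (ofSummable _ h1.summable)).unique h1]

theorem Comparable.exists_bounds {c : ℕ+ → ℝ} {p : ℝ}
    (h : Comparable c fun j => (j : ℝ) ^ p) :
    ∃ k₀ k₁ : ℝ, 0 < k₀ ∧ 0 < k₁ ∧ (∀ j : ℕ+, k₀ * (j : ℝ) ^ p ≤ c j) ∧
      ∀ j : ℕ+, c j ≤ k₁ * (j : ℝ) ^ p := by
  obtain ⟨k₀, k₁, h0, h01, hk⟩ := h
  have hp : ∀ j : ℕ+, 0 < (j : ℝ) ^ p := fun j => Real.rpow_pos_of_pos (Nat.cast_pos.2 j.pos) _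
  exact ⟨k₀, k₁, h0, h0.trans_le h01, fun j => (le_div_iff₀ (hp j)).1 (hk j).1,
    fun j => (div_le_iff₀ (hp j)).1 (hk j).2⟩

theorem tendsto_atTop_of_rpow_le {a : ℕ+ → ℝ} {s k : ℝ} (hs : 0 < s) (hk : 0 < k)
    (ha : ∀ j : ℕ+, k * (j : ℝ) ^ s ≤ a j) : Filter.Tendsto a Filter.atTop Filter.atTop := by
  refine Filter.tendsto_atTop_mono ha (Filter.Tendsto.const_mul_atTop hk ?_)
  exact (tendsto_rpow_atTop hs).comp
    (tendsto_natCast_atTop_atTop.comp tendsto_PNat_val_atTop_atTop)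

end SignalDetection

/-! ### Comparison of the two radii -/

open SignalDetection

theorem proposition4
    (a b : ℕ+ → ℝ) (s t : ℝ) (hs : 0 < s) (ht : 0 < t)
    (ha_pos : ∀ j, 0 < a j) (ha_mono : Monotone a) (hb_pos : ∀ j, 0 < b j)
    (ha : SignalDetection.Comparable a fun j => (j : ℝ) ^ s)
    (hb : SignalDetection.Comparable b fun j => (j : ℝ) ^ (-t))
    (α β : ℝ) (hα : 0 < α) (hβ : 0 < β) (hαβ : α + β < 1)
    (C₀ c' : ℝ) (hC₀ : 0 < C₀) (hc' : 0 < c') :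
    ∃ C ε₀ : ℝ, 1 ≤ C ∧ 0 < ε₀ ∧ ∀ ε : ℝ, 0 < ε → ε < ε₀ →
      (∃ θbar : SignalDetection.Signal,
        SignalDetection.IsExtremal a b ε (SignalDetection.tuningRadius s t C₀ c' ε) θbar) ∧
      ∀ θbar : SignalDetection.Signal,
        SignalDetection.IsExtremal a b ε (SignalDetection.tuningRadius s t C₀ c' ε) θbar →
        SignalDetection.separationRadius a b ε β (SignalDetection.ingsterTest b ε α θbar) ≤
          C * SignalDetection.minimaxRadius a b ε α β := by
  obtain ⟨ka, Ka, hka, hKa, ha_lo, ha_up⟩ := ha.exists_bounds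
  obtain ⟨kb, Kb, hkb, hKb, hb_lo, hb_up⟩ := hb.exists_bounds
  have hB : ∀ j, |b j| ≤ Kb := fun j => by
    rw [abs_of_pos (hb_pos j)]
    refine (hb_up j).trans (mul_le_of_le_one_right hKb.le ?_)
    exact Real.rpow_le_one_of_one_le_of_nonpos (by exact_mod_cast (one_le : 1 ≤ j)) (by linarith)
  have ha_top := tendsto_atTop_of_rpow_le hs hka ha_lo
  set k₁ := min C₀ c'
  set k₂ := max C₀ c'
  have hk₁ : 0 < k₁ := lt_min hC₀ hc'
  have hk₂ : 0 < k₂ := lt_max_of_lt_left hC₀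
  obtain ⟨κ, hκ, henergy⟩ :=
    exists_energy_lower_bound hs ht ha_pos ha_mono hka hkb hk₁ ha_lo hb_lo hB
  obtain ⟨η, hη, hminimax⟩ := exists_minimaxRadius_lower_bound hs ht ha_pos ha_mono hb_pos hKa hKb
    ha_up hb_up hα.le hβ.le hαβ
  set M := 2 * (|gaussianQuantile (1 - α) + 1| + 1) + (8 * gaussianFourthMoment + 32) / β
  have hM0 : 0 ≤ M := by
    have := gaussianFourthMoment_nonneg
    positivity
  set u := √(κ / 2)
  have hu : 0 < u := Real.sqrt_pos.2 (by positivity)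
  -- Gives `C * u = M + u` and `C ≥ 1`, hence `C ^ 2 * u > M`.
  set C := M / u + 1
  have hC1 : 1 ≤ C := le_add_of_nonneg_left (by positivity)
  have hCu : M < C ^ 2 * u := by
    have h1 : C * u = M + u := by rw [add_mul, div_mul_cancel₀ _ hu.ne', one_mul]
    nlinarith
  -- The bound `2` makes `X` admissible in the tuning infimum; the other entry gives `a 1 ^ 2 * ρ ^
  -- 2 ≤ 1`, so that the alternative is nonempty.
  set X₀ := max 2 ((k₂ * a 1 ^ 2) ^ (1 / (2 * s)))
  have hX₀ : 2 ≤ X₀ := le_max_left _ _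
  have hX₀0 : 0 < X₀ := by linarith
  set p := s + t + 1 / 4
  have hp : 0 < p := by positivity
  refine ⟨C * max 1 (√k₂ / η), X₀ ^ (-p), ?_, by positivity, fun ε hε hε₀ => ?_⟩
  · exact one_le_mul_of_one_le_of_one_le hC1 (le_max_left _ _)
  set X := ε ^ (-(1 / p))
  have hXε : X ^ (-p) = ε := by
    rw [← Real.rpow_mul hε.le, neg_mul_neg, one_div_mul_cancel hp.ne', Real.rpow_one]
  have hX0 : 0 < X := Real.rpow_pos_of_pos hε _
  have hXX : X₀ ≤ X := by
    by_contra! hlt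
    have := Real.rpow_le_rpow_of_nonpos hX0 hlt.le (by linarith : -p ≤ 0)
    linarith
  have hX2 : 2 ≤ X := hX₀.trans hXX
  have hε2 : ε ^ 2 = X ^ (-(2 * s + 2 * t + 1 / 2)) := by
    rw [← hXε, ← Real.rpow_natCast, ← Real.rpow_mul hX0.le]
    congr 1; push_cast; ring
  have hε4 : ε ^ 4 = X ^ (-(4 * s + 4 * t + 1)) := by
    rw [← hXε, ← Real.rpow_natCast, ← Real.rpow_mul hX0.le]
    congr 1; push_cast; ring
  obtain ⟨hρ1, hρ2⟩ := tuningRadius_sq_bounds hs ht hC₀ hc' hX2 hε2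
  set ρ := tuningRadius s t C₀ c' ε
  have hρ0 : 0 ≤ ρ := Real.sqrt_nonneg _
  have hρ : 0 < ρ := lt_of_le_of_ne hρ0 fun h0 => by
    have : 0 < k₁ * X ^ (-2 * s) := by positivity
    rw [← h0] at hρ1
    linarith
  refine ⟨exists_isExtremal ha_pos ha_mono ha_top hB hε hρ0 (alternative_nonempty ?_),
    fun θbar hθbar => ?_⟩
  · have h1 : k₂ * a 1 ^ 2 ≤ X ^ (2 * s) := by
      have h0 : 0 ≤ k₂ * a 1 ^ 2 := by positivity
      calc k₂ * a 1 ^ 2 = ((k₂ * a 1 ^ 2) ^ (1 / (2 * s))) ^ (2 * s) := by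
            rw [← Real.rpow_mul h0, one_div_mul_cancel (by positivity), Real.rpow_one]
        _ ≤ X ^ (2 * s) :=
          Real.rpow_le_rpow (by positivity) ((le_max_right _ _).trans hXX) (by positivity)
    have e : X ^ (2 * s) * X ^ (-2 * s) = 1 := by
      rw [← Real.rpow_add hX0, ← Real.rpow_zero X]; congr 1; ring
    calc a 1 ^ 2 * ρ ^ 2 ≤ a 1 ^ 2 * (k₂ * X ^ (-2 * s)) := by gcongr
      _ = k₂ * a 1 ^ 2 * X ^ (-2 * s) := by ring
      _ ≤ X ^ (2 * s) * X ^ (-2 * s) := by gcongr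
      _ = 1 := e
  · have hE := henergy X ρ (by linarith) hρ0 hρ1 θbar hθbar.1
    rw [← hε4] at hE
    have hpos : 0 < ∑' k, b k ^ 4 * θbar k ^ 4 := lt_of_lt_of_le (by positivity) hE
    have hroot : u ≤ √((∑' k, b k ^ 4 * θbar k ^ 4) / 2) / ε ^ 2 := by
      rw [le_div_iff₀ (by positivity)]
      refine Real.le_sqrt_of_sq_le ?_
      rw [mul_pow, Real.sq_sqrt (by positivity)]
      linarith
    have hsep := separationRadius_ingsterTest_le (α := α) hB hε hβ hρ hC1 hθbar hpos
      (hCu.trans_le (by gcongr))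
    have hmm := hminimax X ε (by linarith) hε hε4
    have hρX : ρ ≤ √k₂ * X ^ (-s) := by
      refine le_of_sq_le_sq ?_ (by positivity)
      rw [mul_pow, Real.sq_sqrt hk₂.le, ← Real.rpow_natCast (X ^ (-s)), ← Real.rpow_mul hX0.le]
      refine hρ2.trans_eq ?_
      congr 2; push_cast; ring
    have hXs : 0 < X ^ (-s) := Real.rpow_pos_of_pos hX0 _
    have hmin0 : 0 ≤ minimaxRadius a b ε α β := le_trans (by positivity) hmm
    have hρm : ρ ≤ √k₂ / η * minimaxRadius a b ε α β := by
      calc ρ ≤ √k₂ / η * (η * X ^ (-s)) := by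
            rwa [← mul_assoc, div_mul_cancel₀ _ hη.ne']
        _ ≤ _ := by gcongr
    calc _ ≤ C * ρ := hsep
      _ ≤ C * (√k₂ / η * minimaxRadius a b ε α β) := by gcongr
      _ ≤ C * (max 1 (√k₂ / η) * minimaxRadius a b ε α β) := by
        gcongr
        exact le_max_right _ _
      _ = _ := by ring
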